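/- Let $d\ge 2$, let $\Omega\subset\mathbb{R}^d$ be a bounded Lipschitz domain (open, connected, locally the region above the graph of a Lipschitz function in suitable Cartesian coordinates), and let $\Gamma\subseteq\partial\Omega$ be nonempty and relatively open, equipped with surface measure. Let $L^\infty(\Omega;\mathbb{C}^{d\times d})$ carry the norm $\|B\|=\operatorname{ess\,sup}_{x\in\Omega}\|B(x)\|_2$ with the spectral norm $\|\cdot\|_2$, and let $L^\infty_+(\Omega)$ be the set of those $A\in L^\infty(\Omega;\mathbb{C}^{d\times d})$ for which there is $c_A>0$ such that $\operatorname{ess\,inf}_{x\in\Omega}\operatorname{Re}[(A(x)\xi)\cdot\overline{\xi}]\ge c_A|\xi|^2$ for all $\xi\in\mathbb{C}^d$; any such $c_A$ is called an ellipticity constant of $A$. Let $T:H^1(\Omega)\to L^2(\Gamma)$ be the Dirichlet trace operator onto $\Gamma$, i.e. the bounded linear operator that maps functions smooth up to the boundary to their restrictions to $\Gamma$, and put $$L^2_\diamond(\Gamma)=\Bigl\{g\in L^2(\Gamma): \int_\Gamma g\,dS=0\Bigr\},\qquad H^1_\diamond(\Omega)=\{w\in H^1(\Omega): Tw\in L^2_\diamond(\Gamma)\},\qquad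 \langle w,v\rangle_B=\int_\Omega (B\nabla w)\cdot\overline{\nabla v}\,dx .$$ There is a constant $C$ with $\|w\|_{H^1(\Omega)}^2\le C\int_\Omega|\nabla w|^2\,dx$ for all $w\in H^1_\diamond(\Omega)$, so that on $H^1_\diamond(\Omega)$ the $H^1(\Omega)$-norm and the norm $\|\nabla w\|_{L^2(\Omega)}$ are equivalent. For $A\in L^\infty_+(\Omega)$ there are well-defined bounded linear maps $N(A):L^2_\diamond(\Gamma)\to H^1_\diamond(\Omega)$, $\Lambda(A)=TN(A):L^2_\diamond(\Gamma)\to L^2_\diamond(\Gamma)$ (the local Neumann-to-Dirichlet map) and $P_A: L^\infty(\Omega;\mathbb{C}^{d\times d})\to\mathscr{L}(H^1_\diamond(\Omega))$, where $N(A)f$ and $P_A(B)y$ are the unique elements of $H^1_\diamond(\Omega)$ such that $$\langle N(A)f,v\rangle_A=\langle f,Tv\rangle_{L^2(\Gamma)}\quad\text{and}\quad \langle P_A(B)y,v\rangle_A=-\langle y,v\rangle_B\qquad\text{for all } v\in H^1(\Omega).$$ The set $L^\infty_+(\Omega)$ is open, and the maps $N:L^\infty_+(\Omega)\to\mathscr{L}(L^2_\diamond(\Gamma),H^1_\diamond(\Omega))$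 and $\Lambda:L^\infty_+(\Omega)\to\mathscr{L}(L^2_\diamond(\Gamma))$ are infinitely many times continuously (complex) Fréchet differentiable. For all $A\in L^\infty_+(\Omega)$, $k\in\mathbb{N}\cup\{0\}$ and $B_1,\dots,B_k\in L^\infty(\Omega;\mathbb{C}^{d\times d})$, $$D^kN(A;B_1,\dots,B_k)=\Bigl[\sum_{\alpha}P_A(B_{\alpha_1})\cdots P_A(B_{\alpha_k})\Bigr]N(A),\qquad D^k\Lambda(A;B_1,\dots,B_k)=T\,D^kN(A;B_1,\dots,B_k),$$ where the sum is over all permutations $\alpha=(\alpha_1,\dots,\alpha_k)$ of $(1,\dots,k)$. Both maps are analytic on $L^\infty_+(\Omega)$, and whenever $A\in L^\infty_+(\Omega)$ has ellipticity constant $c_A>0$ and $\|B\|<c_A$, then $A+B\in L^\infty_+(\Omega)$ and $$N(A+B)=\sum_{k=0}^\infty\frac1{k!}D^kN(A;B,\dots,B)=\sum_{k=0}^\infty P_A(B)^kN(A),$$ $$\Lambda(A+B)=\sum_{k=0}^\infty\frac1{k!}D^k\Lambda(A;B,\dots,B)=T\sum_{k=0}^\infty P_A(B)^kN(A),$$ with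 convergence of the series in the respective operator norms. -/

import Mathlib

open MeasureTheory
open scoped ENNReal NNReal ContDiff Matrix.Norms.L2Operator

noncomputable section

/-- A bounded Lipschitz domain of `ℝ^d`: a bounded, nonempty, connected open set which, near each
of its boundary points and in suitable Cartesian coordinates (with vertical direction `e`),
is the region strictly above the graph of a Lipschitz function. -/
structure IsBoundedLipschitzDomain {d : ℕ} (Ω : Set (EuclideanSpace ℝ (Fin d))) : Prop where
  isOpen : IsOpen Ω
  isConnected : IsConnected Ω
  isBounded : Bornology.IsBounded Ω
  exists_graph : ∀ p ∈ frontier Ω,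
    ∃ (e : EuclideanSpace ℝ (Fin d)) (γ : ↥(Submodule.span ℝ {e})ᗮ → ℝ) (K : ℝ≥0) (r : ℝ),
      ‖e‖ = 1 ∧ LipschitzWith K γ ∧ 0 < r ∧
      ∀ x ∈ Metric.ball p r,
        (x ∈ Ω ↔ γ ((Submodule.span ℝ {e})ᗮ.orthogonalProjectionOnto x) < inner ℝ e x)

/-- `Γ` is a relatively open subset of the boundary of `Ω`. -/
def IsRelOpenBoundary {d : ℕ} (Ω Γ : Set (EuclideanSpace ℝ (Fin d))) : Prop :=
  ∃ U : Set (EuclideanSpace ℝ (Fin d)), IsOpen U ∧ Γ = U ∩ frontier Ω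

/-! ### Coefficients -/

/-- `L^∞(Ω; ℂ^{d×d})`, normed by the essential supremum of the spectral norm. -/
abbrev Coeff {d : ℕ} (Ω : Set (EuclideanSpace ℝ (Fin d))) : Type :=
  Lp (Matrix (Fin d) (Fin d) ℂ) ∞ ((volume : Measure (EuclideanSpace ℝ (Fin d))).restrict Ω)

/-- The action of a complex matrix on `ℂ^d` with its Euclidean structure. -/
def matAct {d : ℕ} (M : Matrix (Fin d) (Fin d) ℂ) (ξ : EuclideanSpace ℂ (Fin d)) :
    EuclideanSpace ℂ (Fin d) :=
  WithLp.toLp 2 (M.mulVec ξ)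

/-- `c` is an ellipticity constant of `A`: for every `ξ`, the essential infimum over `Ω` of
`Re (A(x) ξ) · conj ξ` is at least `c |ξ|^2`. Mathlib's inner product is conjugate linear in its
first argument. -/
def IsEllipticityConst {d : ℕ} {Ω : Set (EuclideanSpace ℝ (Fin d))} (A : Coeff Ω) (c : ℝ) : Prop :=
  ∀ ξ : EuclideanSpace ℂ (Fin d), ∀ᵐ x ∂(volume.restrict Ω),
    c * ‖ξ‖ ^ 2 ≤ (inner ℂ ξ (matAct (A x) ξ)).re

/-- The set `L^∞_+(Ω)` of elliptic coefficients. -/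
def ellipticCoeff {d : ℕ} (Ω : Set (EuclideanSpace ℝ (Fin d))) : Set (Coeff Ω) :=
  {A | ∃ c : ℝ, 0 < c ∧ IsEllipticityConst A c}

/-! ### The Sobolev space `H^1(Ω)` -/

/-- `L^2(Ω)`. -/
abbrev L2Dom {d : ℕ} (Ω : Set (EuclideanSpace ℝ (Fin d))) : Type :=
  Lp ℂ 2 ((volume : Measure (EuclideanSpace ℝ (Fin d))).restrict Ω)

/-- `L^2(Ω; ℂ^d)`. -/
abbrev L2VecDom {d : ℕ} (Ω : Set (EuclideanSpace ℝ (Fin d))) : Type :=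
  Lp (EuclideanSpace ℂ (Fin d)) 2 ((volume : Measure (EuclideanSpace ℝ (Fin d))).restrict Ω)

/-- `g` is the weak gradient of `u` in `Ω`. -/
def IsWeakGradient {d : ℕ} {Ω : Set (EuclideanSpace ℝ (Fin d))} (u : L2Dom Ω) (g : L2VecDom Ω) :
    Prop :=
  ∀ φ : EuclideanSpace ℝ (Fin d) → ℝ, ContDiff ℝ ∞ φ → HasCompactSupport φ → tsupport φ ⊆ Ω →
    ∀ i : Fin d,
      ∫ x in Ω, (fderiv ℝ φ x (EuclideanSpace.single i 1)) • u x = - ∫ x in Ω, φ x • g x i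

theorem integrable_smul_L2Dom {d : ℕ} {Ω : Set (EuclideanSpace ℝ (Fin d))}
    {ψ : EuclideanSpace ℝ (Fin d) → ℝ} (hψ : Continuous ψ) (hc : HasCompactSupport ψ)
    {u : EuclideanSpace ℝ (Fin d) → ℂ} (hu : MemLp u 2 (volume.restrict Ω)) :
    Integrable (fun x => ψ x • u x) (volume.restrict Ω) :=
  memLp_one_iff_integrable.1
    (MemLp.smul hu ((hψ.memLp_of_hasCompactSupport (p := 2) (μ := volume) hc).restrict Ω))

theorem memLp_coord {d : ℕ} {Ω : Set (EuclideanSpace ℝ (Fin d))} (g : L2VecDom Ω) (i : Fin d) :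
    MemLp (fun x => g x i) 2 (volume.restrict Ω) :=
  (EuclideanSpace.proj i : EuclideanSpace ℂ (Fin d) →L[ℂ] ℂ).comp_memLp' (Lp.memLp g)

/-- The pairs `(u, ∇u)` of a function in `L^2(Ω)` and its weak gradient in `L^2(Ω; ℂ^d)`; the ambient
norm is `(‖u‖^2 + ‖∇u‖^2)^{1/2}`. -/
def weakGradientGraph {d : ℕ} (Ω : Set (EuclideanSpace ℝ (Fin d))) :
    Submodule ℂ (WithLp 2 (L2Dom Ω × L2VecDom Ω)) where
  carrier := {w | IsWeakGradient w.fst w.snd}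
  zero_mem' := by
    intro φ _ _ _ i
    have h1 : ∫ x in Ω, (fderiv ℝ φ x (EuclideanSpace.single i 1)) • (0 : L2Dom Ω) x = 0 := by
      refine integral_eq_zero_of_ae ?_
      filter_upwards [Lp.coeFn_zero ℂ 2 (volume.restrict Ω)] with x hx
      rw [hx]; simp
    have h2 : ∫ x in Ω, φ x • (0 : L2VecDom Ω) x i = 0 := by
      refine integral_eq_zero_of_ae ?_
      filter_upwards [Lp.coeFn_zero (EuclideanSpace ℂ (Fin d)) 2 (volume.restrict Ω)] with x hx
      rw [hx]; simp
    change ∫ x in Ω, (fderiv ℝ φ x (EuclideanSpace.single i 1)) • (0 : L2Dom Ω) x =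
      - ∫ x in Ω, φ x • (0 : L2VecDom Ω) x i
    rw [h1, h2, neg_zero]
  add_mem' := by
    intro v w hv hw φ hφ hc hs i
    have hd : Continuous fun x => fderiv ℝ φ x (EuclideanSpace.single i 1) :=
      (hφ.continuous_fderiv (by simp)).clm_apply continuous_const
    have hdc : HasCompactSupport fun x => fderiv ℝ φ x (EuclideanSpace.single i 1) :=
      hc.fderiv_apply (𝕜 := ℝ) _
    change ∫ x in Ω, (fderiv ℝ φ x (EuclideanSpace.single i 1)) • (v.fst + w.fst : L2Dom Ω) x =
      - ∫ x in Ω, φ x • (v.snd + w.snd : L2VecDom Ω) x i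
    have h1 : ∫ x in Ω, (fderiv ℝ φ x (EuclideanSpace.single i 1)) • (v.fst + w.fst : L2Dom Ω) x =
        ∫ x in Ω, ((fderiv ℝ φ x (EuclideanSpace.single i 1)) • v.fst x +
          (fderiv ℝ φ x (EuclideanSpace.single i 1)) • w.fst x) := by
      refine integral_congr_ae ?_
      filter_upwards [Lp.coeFn_add v.fst w.fst] with x hx
      rw [hx]; simp [smul_add]
    have h2 : ∫ x in Ω, φ x • (v.snd + w.snd : L2VecDom Ω) x i =
        ∫ x in Ω, (φ x • v.snd x i + φ x • w.snd x i) := by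
      refine integral_congr_ae ?_
      filter_upwards [Lp.coeFn_add v.snd w.snd] with x hx
      rw [hx]; simp [smul_add]
    rw [h1, h2, integral_add (integrable_smul_L2Dom hd hdc (Lp.memLp _))
        (integrable_smul_L2Dom hd hdc (Lp.memLp _)),
      integral_add (integrable_smul_L2Dom hφ.continuous hc (memLp_coord _ i))
        (integrable_smul_L2Dom hφ.continuous hc (memLp_coord _ i)),
      hv φ hφ hc hs i, hw φ hφ hc hs i, neg_add]
  smul_mem' := by
    intro c w hw φ hφ hc hs i
    change ∫ x in Ω, (fderiv ℝ φ x (EuclideanSpace.single i 1)) • (c • w.fst : L2Dom Ω) x =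
      - ∫ x in Ω, φ x • (c • w.snd : L2VecDom Ω) x i
    have h1 : ∫ x in Ω, (fderiv ℝ φ x (EuclideanSpace.single i 1)) • (c • w.fst : L2Dom Ω) x =
        ∫ x in Ω, c • ((fderiv ℝ φ x (EuclideanSpace.single i 1)) • w.fst x) := by
      refine integral_congr_ae ?_
      filter_upwards [Lp.coeFn_smul c w.fst] with x hx
      rw [hx]; simp [mul_left_comm]
    have h2 : ∫ x in Ω, φ x • (c • w.snd : L2VecDom Ω) x i =
        ∫ x in Ω, c • (φ x • w.snd x i) := by
      refine integral_congr_ae ?_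
      filter_upwards [Lp.coeFn_smul c w.snd] with x hx
      rw [hx]; simp [mul_left_comm]
    rw [h1, h2, integral_smul, integral_smul, hw φ hφ hc hs i, smul_neg]

/-- `H^1(Ω)`, the functions in `L^2(Ω)` with weak gradient in `L^2(Ω; ℂ^d)`. An element is recorded
as the pair of the function and its (unique) weak gradient. -/
def H1 {d : ℕ} (Ω : Set (EuclideanSpace ℝ (Fin d))) : Type := ↥(weakGradientGraph Ω)

instance {d : ℕ} (Ω : Set (EuclideanSpace ℝ (Fin d))) : NormedAddCommGroup (H1 Ω) :=
  inferInstanceAs (NormedAddCommGroup ↥(weakGradientGraph Ω))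

instance {d : ℕ} (Ω : Set (EuclideanSpace ℝ (Fin d))) : InnerProductSpace ℂ (H1 Ω) :=
  inferInstanceAs (InnerProductSpace ℂ ↥(weakGradientGraph Ω))

/-- The underlying function of an element of `H^1(Ω)`. -/
def H1.toFun {d : ℕ} {Ω : Set (EuclideanSpace ℝ (Fin d))} (w : H1 Ω) : L2Dom Ω :=
  w.val.fst

/-- The weak gradient of an element of `H^1(Ω)`. -/
def H1.grad {d : ℕ} {Ω : Set (EuclideanSpace ℝ (Fin d))} (w : H1 Ω) : L2VecDom Ω :=
  w.val.snd

/-- The sesquilinear form `⟨w, v⟩_B = ∫_Ω (B ∇w) · conj (∇v) dx`. -/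
def coeffForm {d : ℕ} {Ω : Set (EuclideanSpace ℝ (Fin d))} (B : Coeff Ω) (w v : H1 Ω) : ℂ :=
  ∫ x in Ω, inner ℂ (H1.grad v x) (matAct (B x) (H1.grad w x))

/-! ### The boundary piece and the trace -/

/-- The surface measure on `Γ`: the `(d-1)`-dimensional Hausdorff measure, normalised to agree with
Lebesgue measure on hyperplanes. -/
def surfaceMeasure {d : ℕ} (Γ : Set (EuclideanSpace ℝ (Fin d))) :
    Measure (EuclideanSpace ℝ (Fin d)) :=
  (Measure.euclideanHausdorffMeasure (d - 1)).restrict Γ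

/-- `L^2(Γ)`. -/
abbrev L2Bd {d : ℕ} (Γ : Set (EuclideanSpace ℝ (Fin d))) : Type :=
  Lp ℂ 2 (surfaceMeasure Γ)

/-- `T` is the Dirichlet trace operator onto `Γ`: the bounded linear operator from `H^1(Ω)` to
`L^2(Γ)` that maps (the restriction to `Ω` of) a function smooth up to the boundary to its pointwise
restriction to `Γ`. -/
def IsTraceOp {d : ℕ} (Ω Γ : Set (EuclideanSpace ℝ (Fin d))) (T : H1 Ω →L[ℂ] L2Bd Γ) : Prop :=
  ∀ (w : H1 Ω) (φ : EuclideanSpace ℝ (Fin d) → ℂ), ContDiff ℝ ∞ φ →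
    H1.toFun w =ᵐ[volume.restrict Ω] φ → T w =ᵐ[surfaceMeasure Γ] φ

/-- The Dirichlet trace operator `T : H^1(Ω) → L^2(Γ)`. -/
def traceOp {d : ℕ} (Ω Γ : Set (EuclideanSpace ℝ (Fin d))) : H1 Ω →L[ℂ] L2Bd Γ :=
  Classical.epsilon (IsTraceOp Ω Γ)

/-- `L^2_⋄(Γ)`, the elements of `L^2(Γ)` with mean zero. (Integrability is automatic when `Γ` has
finite surface measure.) -/
def L2Mean {d : ℕ} (Γ : Set (EuclideanSpace ℝ (Fin d))) : Submodule ℂ (L2Bd Γ) where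
  carrier := {g | Integrable g (surfaceMeasure Γ) ∧ ∫ x, g x ∂(surfaceMeasure Γ) = 0}
  zero_mem' := by
    have h := Lp.coeFn_zero ℂ 2 (surfaceMeasure Γ)
    exact ⟨(integrable_zero _ _ _).congr h.symm, integral_eq_zero_of_ae h⟩
  add_mem' := by
    rintro f g ⟨hf, hf0⟩ ⟨hg, hg0⟩
    have h := Lp.coeFn_add f g
    refine ⟨(hf.add hg).congr h.symm, ?_⟩
    rw [integral_congr_ae h, integral_add' hf hg, hf0, hg0, add_zero]
  smul_mem' := by
    rintro c f ⟨hf, hf0⟩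
    have h := Lp.coeFn_smul c f
    refine ⟨(hf.smul c).congr h.symm, ?_⟩
    rw [integral_congr_ae h]
    simp only [Pi.smul_apply]
    rw [integral_smul, hf0, smul_zero]

/-- `H^1_⋄(Ω)`, the elements of `H^1(Ω)` whose trace on `Γ` has mean zero. -/
def H1Mean {d : ℕ} (Ω Γ : Set (EuclideanSpace ℝ (Fin d))) : Submodule ℂ (H1 Ω) :=
  (L2Mean Γ).comap (traceOp Ω Γ).toLinearMap

/-- The trace operator as a map `H^1_⋄(Ω) → L^2_⋄(Γ)`. -/
def traceMean {d : ℕ} (Ω Γ : Set (EuclideanSpace ℝ (Fin d))) : H1Mean Ω Γ →L[ℂ] L2Mean Γ :=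
  ((traceOp Ω Γ).comp (H1Mean Ω Γ).subtypeL).codRestrict (L2Mean Γ) fun w => w.2

/-! ### The continuum model -/

/-- `u` is a weak solution of `-∇·(A∇u) = 0` in `Ω` with Neumann data `f` on `Γ` and `0` on the rest
of the boundary: `⟨u, v⟩_A = ⟨f, T v⟩_{L^2(Γ)}` for all `v ∈ H^1(Ω)`. -/
def IsWeakSolution {d : ℕ} {Ω Γ : Set (EuclideanSpace ℝ (Fin d))} (A : Coeff Ω) (f : L2Mean Γ)
    (u : H1Mean Ω Γ) : Prop :=
  ∀ v : H1 Ω, coeffForm A (u : H1 Ω) v = inner ℂ (traceOp Ω Γ v) (f : L2Bd Γ)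

/-- The solution operator `N(A) : f ↦ u`. -/
def solOp {d : ℕ} (Ω Γ : Set (EuclideanSpace ℝ (Fin d))) (A : Coeff Ω) :
    L2Mean Γ →L[ℂ] H1Mean Ω Γ :=
  Classical.epsilon fun S => ∀ f : L2Mean Γ, IsWeakSolution A f (S f)

/-- The local Neumann-to-Dirichlet map `Λ(A) = T N(A)`. -/
def ndMap {d : ℕ} (Ω Γ : Set (EuclideanSpace ℝ (Fin d))) (A : Coeff Ω) :
    L2Mean Γ →L[ℂ] L2Mean Γ :=
  traceMean Ω Γ ∘L solOp Ω Γ A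

/-- `z` solves the variational problem `⟨z, v⟩_A = -⟨y, v⟩_B` for all `v ∈ H^1(Ω)`. -/
def IsPerturbSolution {d : ℕ} {Ω Γ : Set (EuclideanSpace ℝ (Fin d))} (A B : Coeff Ω)
    (y z : H1Mean Ω Γ) : Prop :=
  ∀ v : H1 Ω, coeffForm A (z : H1 Ω) v = - coeffForm B (y : H1 Ω) v

/-- The operator `P_A : L^∞(Ω; ℂ^{d×d}) → 𝓛(H^1_⋄(Ω))`. -/
def perturbOp {d : ℕ} (Ω Γ : Set (EuclideanSpace ℝ (Fin d))) (A : Coeff Ω) :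
    Coeff Ω →L[ℂ] (H1Mean Ω Γ →L[ℂ] H1Mean Ω Γ) :=
  Classical.epsilon fun P => ∀ (B : Coeff Ω) (y : H1Mean Ω Γ), IsPerturbSolution A B y (P B y)

end

/-! On `H1Mean Ω Γ` the form of a coefficient `B` is represented by the operator `M(B) = D* B D`,
with `D` the weak gradient, and the boundary data by an operator `R` built from the adjoint of the
trace. `M` is linear in `B`. For elliptic `A`, the Poincaré inequality makes `M(A)` coercive, hence
invertible (`isUnit_of_coercive`), so `N(A) = M(A)⁻¹ R` and `P_A(B) = -M(A)⁻¹ M(B)`. Linearity gives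
`M(A + B) = M(A)(1 - P_A(B))`, that is, `N(A + B) = (1 - P_A(B))⁻¹ N(A)` (`solOp_add_eq`).
Analyticity and the derivatives then come from the geometric series in `P_A(B)`; composing with the
bounded trace transfers them to `Λ`.

Convergence on all of `‖B‖ < c` is finer than the local statement, since in the `H¹` operator norm
`P_A(B)` need not be a contraction. In the equivalent norm `‖∇w‖` it is one, with factor `‖B‖ / c`
(`norm_grad_perturbOp_le`), and this suffices for summability of its powers.

Test functions range over all of `H¹(Ω)`, but each is a constant plus an element of `H1Mean Ω Γ`;
constants have zero gradient and pair to zero with mean-free data.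

The geometry supplies three facts: `Γ` has finite positive surface measure (Lipschitz graph charts),
the trace exists (a one-dimensional estimate on vertical segments, integrated over each chart), and
the Poincaré inequality holds. The last is proved without compact embeddings: a translation by `v`
changes `u` in `L²` by at most `2 |v| ‖∇u‖`. Averaging over translations compares `u` with a
constant on a ball, further translations spread this over `Ω` up to the boundary, and the mean-zero
trace bounds the constant. -/

/-! ### Coercive operators and Neumann series -/

/-- The complex Lax–Milgram theorem: a bounded operator with coercive real part is invertible. -/
theorem isUnit_of_coercive {H : Type*} [NormedAddCommGroup H] [InnerProductSpace ℂ H]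
    [CompleteSpace H] (S : H →L[ℂ] H) {c : ℝ} (hc : 0 < c)
    (hS : ∀ u, c * ‖u‖ ^ 2 ≤ (inner ℂ u (S u)).re) : IsUnit S := by
  have hbelow : ∀ u, c * ‖u‖ ≤ ‖S u‖ := by
    intro u
    rcases eq_or_ne u 0 with rfl | hu
    · simp
    have hu' : 0 < ‖u‖ := norm_pos_iff.2 hu
    refine le_of_mul_le_mul_right ?_ hu'
    calc c * ‖u‖ * ‖u‖ = c * ‖u‖ ^ 2 := by ring
      _ ≤ (inner ℂ u (S u)).re := hS u
      _ ≤ ‖inner ℂ u (S u)‖ := Complex.re_le_norm _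
      _ ≤ ‖u‖ * ‖S u‖ := norm_inner_le_norm _ _
      _ = ‖S u‖ * ‖u‖ := mul_comm _ _
  have hanti : AntilipschitzWith (c⁻¹.toNNReal) S := by
    refine S.antilipschitz_of_bound fun u => ?_
    rw [Real.coe_toNNReal _ (inv_pos.2 hc).le, inv_mul_eq_div, le_div_iff₀ hc, mul_comm]
    exact hbelow u
  have hclosed : IsClosed (S.range : Set H) := hanti.isClosed_range S.uniformContinuous
  have hrange : S.range = ⊤ := by
    have := hclosed.completeSpace_coe
    rw [← Submodule.orthogonal_eq_bot_iff, Submodule.eq_bot_iff]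
    intro w hw
    -- A vector orthogonal to the range is orthogonal to its own image, so coercivity forces it to
    -- vanish.
    have h0 : inner ℂ w (S w) = 0 := by
      rw [← inner_conj_symm, (Submodule.mem_orthogonal _ _).1 hw (S w) ⟨w, rfl⟩, map_zero]
    have h1 := hS w
    rw [h0, Complex.zero_re] at h1
    have h2 : ‖w‖ ^ 2 ≤ 0 := by
      by_contra h
      push Not at h
      nlinarith [mul_pos hc h]
    simpa using le_antisymm h2 (sq_nonneg _)
  refine ContinuousLinearMap.isUnit_iff_bijective.2 ⟨hanti.injective, ?_⟩
  exact LinearMap.range_eq_top.1 hrange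

/-- If the geometric series of `x` is summable, it sums to the inverse of `1 - x`. -/
theorem hasSum_pow_inverse_one_sub {R : Type*} [Ring R] [TopologicalSpace R] [IsTopologicalRing R]
    [T2Space R] {x : R} (h : Summable fun k : ℕ => x ^ k) :
    IsUnit (1 - x) ∧ HasSum (fun k : ℕ => x ^ k) (Ring.inverse (1 - x)) := by
  -- Summability replaces the usual condition `‖x‖ < 1`, which can fail for an operator contractive
  -- only in an equivalent norm.
  let u : Rˣ := ⟨1 - x, ∑' k : ℕ, x ^ k, h.one_sub_mul_tsum_pow, h.tsum_pow_mul_one_sub⟩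
  have hu : Ring.inverse (1 - x) = ∑' k : ℕ, x ^ k := Ring.inverse_unit u
  exact ⟨⟨u, rfl⟩, hu ▸ h.hasSum⟩

/-! ### Power series and derivatives of the Neumann inverse -/

section PowerSeries

variable {X H F : Type*} [NormedAddCommGroup X] [NormedSpace ℂ X] [NormedAddCommGroup H]
  [NormedSpace ℂ H] [NormedAddCommGroup F] [NormedSpace ℂ F]

/-- The power series of `a + b ↦ (1 - P b)⁻¹ ∘ N₀`. -/
noncomputable def neumannSeries (P : X →L[ℂ] (H →L[ℂ] H)) (N₀ : F →L[ℂ] H) :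
    FormalMultilinearSeries ℂ X (F →L[ℂ] H) :=
  ((ContinuousLinearMap.compL ℂ F H H).flip N₀).compFormalMultilinearSeries
    ((formalMultilinearSeries_geometric ℂ (H →L[ℂ] H)).compContinuousLinearMap P)

/-- The factors need not commute, so these coefficients are not symmetric in `b`; this is the origin
of the permutations in the derivatives. -/
theorem neumannSeries_apply (P : X →L[ℂ] (H →L[ℂ] H)) (N₀ : F →L[ℂ] H) (k : ℕ) (b : Fin k → X) :
    neumannSeries P N₀ k b = (List.ofFn fun i => P (b i)).prod ∘L N₀ := by
  simp [neumannSeries, formalMultilinearSeries_geometric, Function.comp_def]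

theorem hasFPowerSeriesAt_neumannSeries [CompleteSpace H] {f : X → (F →L[ℂ] H)} {a : X}
    (P : X →L[ℂ] (H →L[ℂ] H)) (N₀ : F →L[ℂ] H)
    (hf : ∀ᶠ x in nhds a, f x = Ring.inverse (1 - P (x - a)) ∘L N₀) :
    HasFPowerSeriesAt f (neumannSeries P N₀) a := by
  have h1 : HasFPowerSeriesOnBall (fun x : H →L[ℂ] H => Ring.inverse (1 - x))
      (formalMultilinearSeries_geometric ℂ (H →L[ℂ] H)) (P 0) 1 := by
    rw [map_zero]
    exact hasFPowerSeriesOnBall_inverse_one_sub ℂ (H →L[ℂ] H)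
  have h2 := h1.compContinuousLinearMap
  have h3 := ((ContinuousLinearMap.compL ℂ F H H).flip N₀).comp_hasFPowerSeriesOnBall h2
  have h4 := (h3.comp_sub a).hasFPowerSeriesAt
  rw [zero_add] at h4
  refine h4.congr ?_
  filter_upwards [hf] with x hx
  simp [hx]

/-- The `k`-th derivative of a power series at its centre is the sum of its `k`-th coefficient over
all orderings of the arguments. -/
theorem iteratedFDeriv_eq_sum_perm [CompleteSpace H] {f : X → (F →L[ℂ] H)} {a : X}
    (P : X →L[ℂ] (H →L[ℂ] H)) (N₀ : F →L[ℂ] H)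
    (hf : ∀ᶠ x in nhds a, f x = Ring.inverse (1 - P (x - a)) ∘L N₀) (k : ℕ) (b : Fin k → X) :
    iteratedFDeriv ℂ k f a b =
      (∑ α : Equiv.Perm (Fin k), (List.ofFn fun i : Fin k => P (b (α i))).prod) ∘L N₀ := by
  obtain ⟨r, hr⟩ := hasFPowerSeriesAt_neumannSeries P N₀ hf
  rw [hr.iteratedFDeriv_eq_sum_of_completeSpace]
  simp only [neumannSeries_apply]
  ext x
  simp

end PowerSeries

/-- For an affine perturbation of an invertible operator,
`(M (a + b))⁻¹ R = (1 - P b)⁻¹ (M a)⁻¹ R` with `P b = -(M a)⁻¹ (M b)`. -/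
theorem inverse_add_eq {X H : Type*} [NormedAddCommGroup X] [NormedSpace ℂ X]
    [NormedAddCommGroup H] [NormedSpace ℂ H] (M : X →L[ℂ] (H →L[ℂ] H)) (a b : X) (ha : IsUnit (M a)) :
    Ring.inverse (M (a + b)) =
      Ring.inverse (1 - -(Ring.inverse (M a) * M b)) * Ring.inverse (M a) := by
  obtain ⟨u, hu⟩ := ha
  have h : M (a + b) = u * (1 - -(Ring.inverse (M a) * M b)) := by
    rw [← hu, Ring.inverse_unit, sub_neg_eq_add, mul_add, mul_one, Units.mul_inv_cancel_left, hu,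
      map_add]
  rw [h, ← hu, Ring.inverse_unit]
  generalize hz : (1 - -(((u⁻¹ : (H →L[ℂ] H)ˣ) : H →L[ℂ] H) * M b)) = z
  -- No invertibility of `1 - P b` is assumed: when it fails, `M (a + b)` is not invertible either
  -- and both sides are `0`, the default value of `Ring.inverse`.
  by_cases hzu : IsUnit z
  · obtain ⟨v, rfl⟩ := hzu
    rw [Ring.inverse_unit, ← Units.val_mul, Ring.inverse_unit, mul_inv_rev, Units.val_mul]
  · rw [Ring.inverse_non_unit z hzu, zero_mul, Ring.inverse_non_unit]
    intro hh
    exact hzu ((Units.isUnit_units_mul u z).1 hh)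

/-! ### Operators defined by forms -/

section Form

variable {X H V F G : Type*} [NormedAddCommGroup X] [NormedSpace ℂ X]
  [NormedAddCommGroup H] [InnerProductSpace ℂ H]
  [NormedAddCommGroup V] [InnerProductSpace ℂ V]
  [NormedAddCommGroup F] [NormedSpace ℂ F] [NormedAddCommGroup G] [NormedSpace ℂ G]

/-- The operators representing the forms `(w, v) ↦ ⟨D v, m b (D w)⟩`. -/
noncomputable def sandwich [CompleteSpace H] [CompleteSpace V] (D : H →L[ℂ] V)
    (m : X →L[ℂ] V →L[ℂ] V) : X →L[ℂ] H →L[ℂ] H :=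
  (ContinuousLinearMap.compL ℂ H V H (ContinuousLinearMap.adjoint D)).comp
    (((ContinuousLinearMap.compL ℂ H V V).flip D).comp m)

theorem inner_sandwich [CompleteSpace H] [CompleteSpace V] (D : H →L[ℂ] V) (m : X →L[ℂ] V →L[ℂ] V)
    (b : X) (w v : H) :
    inner ℂ v (sandwich D m b w) = inner ℂ (D v) (m b (D w)) := by
  rw [← ContinuousLinearMap.adjoint_inner_right]
  rfl

/-- The family `b ↦ -S⁻¹ (M b)`. -/
noncomputable def negInverseMul (M : X →L[ℂ] H →L[ℂ] H) (S : H →L[ℂ] H) : X →L[ℂ] H →L[ℂ] H :=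
  -(ContinuousLinearMap.compL ℂ H H H (Ring.inverse S)).comp M

theorem apply_eq_iff_eq_inverse_apply {S : H →L[ℂ] H} (hS : IsUnit S) (x y : H) :
    S x = y ↔ x = Ring.inverse S y := by
  constructor
  · rintro rfl
    rw [← mul_apply_eq_comp, Ring.inverse_mul_cancel S hS]
    rfl
  · rintro rfl
    rw [← mul_apply_eq_comp, Ring.mul_inverse_cancel S hS]
    rfl

/-- The contraction is iterated in the seminorm `‖D ·‖`, and norms are compared only once at each
end, so the comparison constants are not raised to the power `k`. The absolute value covers a `C` of
unspecified sign. -/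
theorem norm_pow_le_of_contractive (D : H →L[ℂ] V) (P : H →L[ℂ] H) {C q : ℝ}
    (hC : ∀ w, ‖w‖ ^ 2 ≤ C * ‖D w‖ ^ 2) (hq0 : 0 ≤ q)
    (hP : ∀ y, ‖D (P y)‖ ≤ q * ‖D y‖) (k : ℕ) : ‖P ^ k‖ ≤ √|C| * ‖D‖ * q ^ k := by
  have h1 : ∀ y : H, ‖D ((P ^ k) y)‖ ≤ q ^ k * ‖D y‖ := by
    induction k with
    | zero => intro y; simp
    | succ k ih =>
      intro y
      rw [pow_succ', mul_apply_eq_comp, pow_succ', mul_assoc]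
      exact (hP _).trans (mul_le_mul_of_nonneg_left (ih y) hq0)
  refine ContinuousLinearMap.opNorm_le_bound _ (by positivity) fun y => ?_
  set z := (P ^ k) y with hz
  have h2 : ‖z‖ ≤ √|C| * ‖D z‖ := by
    refine (pow_le_pow_iff_left₀ (norm_nonneg z) (by positivity) two_ne_zero).1 ?_
    rw [mul_pow, Real.sq_sqrt (abs_nonneg _)]
    exact (hC z).trans (mul_le_mul_of_nonneg_right (le_abs_self C) (sq_nonneg _))
  have h3 : ‖D z‖ ≤ q ^ k * (‖D‖ * ‖y‖) :=
    (h1 y).trans (mul_le_mul_of_nonneg_left (D.le_opNorm y) (pow_nonneg hq0 k))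
  calc ‖z‖ ≤ √|C| * (q ^ k * (‖D‖ * ‖y‖)) :=
        h2.trans (mul_le_mul_of_nonneg_left h3 (Real.sqrt_nonneg _))
    _ = √|C| * ‖D‖ * q ^ k * ‖y‖ := by ring

/-- An operator which is contractive for an equivalent norm has a summable geometric series. -/
theorem summable_pow_of_contractive [CompleteSpace H] (D : H →L[ℂ] V) (P : H →L[ℂ] H) {C q : ℝ}
    (hC : ∀ w, ‖w‖ ^ 2 ≤ C * ‖D w‖ ^ 2) (hq0 : 0 ≤ q) (hq1 : q < 1)
    (hP : ∀ y, ‖D (P y)‖ ≤ q * ‖D y‖) : Summable fun k : ℕ => P ^ k :=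
  Summable.of_norm_bounded ((summable_geometric_of_lt_one hq0 hq1).mul_left _)
    (norm_pow_le_of_contractive D P hC hq0 hP)

theorem hasSum_pow_comp {P : H →L[ℂ] H} (h : Summable fun k : ℕ => P ^ k) (N₀ : F →L[ℂ] H) :
    HasSum (fun k : ℕ => (P ^ k) ∘L N₀) (Ring.inverse (1 - P) ∘L N₀) :=
  (hasSum_pow_inverse_one_sub h).2.mapL ((ContinuousLinearMap.compL ℂ F H H).flip N₀)

theorem HasSum.clm_comp_left {f : ℕ → F →L[ℂ] H} {s : F →L[ℂ] H} (h : HasSum f s)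
    (t : H →L[ℂ] G) : HasSum (fun k => t ∘L f k) (t ∘L s) :=
  h.mapL (ContinuousLinearMap.compL ℂ F H G t)

theorem AnalyticAt.clm_comp_left {f : X → (F →L[ℂ] H)} {a : X} (h : AnalyticAt ℂ f a)
    (t : H →L[ℂ] G) : AnalyticAt ℂ (fun x => t ∘L f x) a :=
  ((ContinuousLinearMap.compL ℂ F H G t).analyticAt _).comp h

theorem iteratedFDeriv_clm_comp_left [CompleteSpace H] {f : X → (F →L[ℂ] H)} {a : X}
    (h : AnalyticAt ℂ f a)
    (t : H →L[ℂ] G) (k : ℕ) (b : Fin k → X) :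
    iteratedFDeriv ℂ k (fun x => t ∘L f x) a b = t ∘L iteratedFDeriv ℂ k f a b := by
  have h := (ContinuousLinearMap.compL ℂ F H G t).iteratedFDeriv_comp_left
    (f := f) (x := a) (n := k) h.contDiffAt (i := k) le_rfl
  exact congrArg (fun m => m b) h

/-- With equal arguments all `k!` orderings give the same product, which cancels the factorial. -/
theorem inv_factorial_smul_iteratedFDeriv [CompleteSpace H] {f : X → (F →L[ℂ] H)} {a : X}
    (P : X →L[ℂ] (H →L[ℂ] H)) (N₀ : F →L[ℂ] H)
    (hf : ∀ᶠ x in nhds a, f x = Ring.inverse (1 - P (x - a)) ∘L N₀) (k : ℕ) (b : X) :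
    ((k.factorial : ℂ)⁻¹) • iteratedFDeriv ℂ k f a (fun _ => b) = (P b ^ k) ∘L N₀ := by
  rw [iteratedFDeriv_eq_sum_perm P N₀ hf]
  have hk : (k.factorial : ℂ) ≠ 0 := by exact_mod_cast k.factorial_ne_zero
  simp only [List.ofFn_const, List.prod_replicate, Finset.sum_const, Finset.card_univ,
    Fintype.card_perm, Fintype.card_fin]
  rw [← Nat.cast_smul_eq_nsmul ℂ, ContinuousLinearMap.smul_comp, smul_smul, inv_mul_cancel₀ hk,
    one_smul]

end Form

/-! ### The Hilbert space `H^1(Ω)` -/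

section Sobolev

variable {d : ℕ} {Ω : Set (EuclideanSpace ℝ (Fin d))}

/-- A continuous compactly supported function as an element of `L^2(Ω)`. -/
noncomputable def testL2 (Ω : Set (EuclideanSpace ℝ (Fin d))) {ψ : EuclideanSpace ℝ (Fin d) → ℝ}
    (hψ : Continuous ψ) (hc : HasCompactSupport ψ) : Lp ℝ 2 (volume.restrict Ω) :=
  ((hψ.memLp_of_hasCompactSupport (p := 2) (μ := volume) hc).restrict Ω).toLp ψ

/-- Integration against a continuous compactly supported function, on `L^2(Ω)`. -/
noncomputable def testPairing (Ω : Set (EuclideanSpace ℝ (Fin d)))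
    {ψ : EuclideanSpace ℝ (Fin d) → ℝ}
    (hψ : Continuous ψ) (hc : HasCompactSupport ψ) : L2Dom Ω →L[ℝ] ℂ :=
  (ContinuousLinearMap.lsmul ℝ ℝ : ℝ →L[ℝ] ℂ →L[ℝ] ℂ).lpPairing (volume.restrict Ω) 2 2
    (testL2 Ω hψ hc)

theorem testPairing_apply {ψ : EuclideanSpace ℝ (Fin d) → ℝ} (hψ : Continuous ψ)
    (hc : HasCompactSupport ψ) (u : L2Dom Ω) :
    testPairing Ω hψ hc u = ∫ x in Ω, ψ x • u x := by
  rw [testPairing, ContinuousLinearMap.lpPairing_eq_integral]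
  refine integral_congr_ae ?_
  filter_upwards [MemLp.coeFn_toLp
    ((hψ.memLp_of_hasCompactSupport (p := 2) (μ := volume) hc).restrict Ω)] with x hx
  rw [testL2, hx]
  rfl

/-- The `i`-th coordinate of a vector field, as an operator `L^2(Ω; ℂ^d) → L^2(Ω)`. -/
noncomputable def coordL2 (Ω : Set (EuclideanSpace ℝ (Fin d))) (i : Fin d) :
    L2VecDom Ω →L[ℂ] L2Dom Ω :=
  (EuclideanSpace.proj i : EuclideanSpace ℂ (Fin d) →L[ℂ] ℂ).compLpL 2 (volume.restrict Ω)

theorem coordL2_ae (g : L2VecDom Ω) (i : Fin d) :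
    coordL2 Ω i g =ᵐ[volume.restrict Ω] fun x => g x i :=
  ContinuousLinearMap.coeFn_compLpL _ _

/-- Each test function and coordinate imposes an equation between continuous functions of the pair,
so the graph is an intersection of closed sets. Completeness of `H1 Ω` rests on this. -/
theorem isClosed_weakGradientGraph :
    IsClosed (weakGradientGraph Ω : Set (WithLp 2 (L2Dom Ω × L2VecDom Ω))) := by
  have key : (weakGradientGraph Ω : Set (WithLp 2 (L2Dom Ω × L2VecDom Ω))) =
      ⋂ (φ : EuclideanSpace ℝ (Fin d) → ℝ) (hφ : ContDiff ℝ ∞ φ) (hc : HasCompactSupport φ)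
        (_ : tsupport φ ⊆ Ω) (i : Fin d),
        {w | testPairing Ω ((hφ.continuous_fderiv (by simp)).clm_apply
              (continuous_const (y := EuclideanSpace.single i (1 : ℝ))))
              (hc.fderiv_apply (𝕜 := ℝ) _) w.fst
          = - testPairing Ω hφ.continuous hc (coordL2 Ω i w.snd)} := by
    ext w
    simp only [Set.mem_iInter, Set.mem_ofPred_eq, testPairing_apply]
    refine forall_congr' fun φ => forall_congr' fun hφ => forall_congr' fun hc =>
      forall_congr' fun hs => forall_congr' fun i => ?_
    have : ∫ x in Ω, φ x • coordL2 Ω i w.snd x = ∫ x in Ω, φ x • w.snd x i := by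
      refine integral_congr_ae ?_
      filter_upwards [coordL2_ae w.snd i] with x hx
      rw [hx]
    rw [this]
  rw [key]
  refine isClosed_iInter fun φ => isClosed_iInter fun hφ => isClosed_iInter fun hc =>
    isClosed_iInter fun hs => isClosed_iInter fun i => isClosed_eq ?_ ?_
  · exact (testPairing Ω _ _).continuous.comp (WithLp.continuous_fst 2 _ _)
  · exact ((testPairing Ω _ _).continuous.comp
      ((coordL2 Ω i).continuous.comp (WithLp.continuous_snd 2 _ _))).neg

instance : CompleteSpace (H1 Ω) :=
  (isClosed_weakGradientGraph (Ω := Ω)).completeSpace_coe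

/-- The weak gradient as a bounded operator on `H^1(Ω)`. -/
noncomputable def gradL (Ω : Set (EuclideanSpace ℝ (Fin d))) : H1 Ω →L[ℂ] L2VecDom Ω :=
  (WithLp.sndL 2 ℂ (L2Dom Ω) (L2VecDom Ω)).comp (weakGradientGraph Ω).subtypeL

theorem gradL_apply (w : H1 Ω) : gradL Ω w = H1.grad w := rfl

/-- The inclusion of `H^1(Ω)` in `L^2(Ω)`. -/
noncomputable def toFunL (Ω : Set (EuclideanSpace ℝ (Fin d))) : H1 Ω →L[ℂ] L2Dom Ω :=
  (WithLp.fstL 2 ℂ (L2Dom Ω) (L2VecDom Ω)).comp (weakGradientGraph Ω).subtypeL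

theorem toFunL_apply (w : H1 Ω) : toFunL Ω w = H1.toFun w := rfl

theorem H1.norm_sq_eq (w : H1 Ω) : ‖w‖ ^ 2 = ‖H1.toFun w‖ ^ 2 + ‖H1.grad w‖ ^ 2 :=
  WithLp.prod_norm_sq_eq_of_L2 _

/-! ### The form operators -/

/-- The action of matrices on vectors as a bounded bilinear map. -/
noncomputable def matActL (d : ℕ) : Matrix (Fin d) (Fin d) ℂ →L[ℂ]
    EuclideanSpace ℂ (Fin d) →L[ℂ] EuclideanSpace ℂ (Fin d) :=
  LinearMap.mkContinuous
    (Matrix.toEuclideanCLM (n := Fin d) (𝕜 := ℂ)).toAlgEquiv.toLinearMap 1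
    fun M => by rw [one_mul]; exact (Matrix.l2_opNorm_toEuclideanCLM M).le

theorem matActL_apply (M : Matrix (Fin d) (Fin d) ℂ) (ξ : EuclideanSpace ℂ (Fin d)) :
    matActL d M ξ = matAct M ξ := rfl

theorem norm_matAct_le (M : Matrix (Fin d) (Fin d) ℂ) (ξ : EuclideanSpace ℂ (Fin d)) :
    ‖matAct M ξ‖ ≤ ‖M‖ * ‖ξ‖ := M.l2_opNorm_mulVec ξ

theorem norm_matActL_le : ‖matActL d‖ ≤ 1 := LinearMap.mkContinuous_norm_le _ zero_le_one _

/-- Multiplication of vector fields by a coefficient. -/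
noncomputable def coeffMul (Ω : Set (EuclideanSpace ℝ (Fin d))) :
    Coeff Ω →L[ℂ] L2VecDom Ω →L[ℂ] L2VecDom Ω :=
  (matActL d).holderL (volume.restrict Ω) ∞ 2 2

theorem coeffMul_ae (B : Coeff Ω) (g : L2VecDom Ω) :
    coeffMul Ω B g =ᵐ[volume.restrict Ω] fun x => matAct (B x) (g x) :=
  (matActL d).coeFn_holder B g

theorem norm_coeffMul_apply_le (B : Coeff Ω) (g : L2VecDom Ω) :
    ‖coeffMul Ω B g‖ ≤ ‖B‖ * ‖g‖ := by
  refine ((matActL d).norm_holder_apply_apply_le B g).trans ?_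
  have := norm_matActL_le (d := d)
  gcongr
  nlinarith [norm_nonneg B]

theorem inner_coeffMul (B : Coeff Ω) (g h : L2VecDom Ω) :
    inner ℂ h (coeffMul Ω B g) = ∫ x in Ω, inner ℂ (h x) (matAct (B x) (g x)) := by
  rw [L2.inner_def]
  refine integral_congr_ae ?_
  filter_upwards [coeffMul_ae B g] with x hx
  rw [hx]

theorem coeffForm_eq_inner (B : Coeff Ω) (w v : H1 Ω) :
    coeffForm B w v = inner ℂ (H1.grad v) (coeffMul Ω B (H1.grad w)) :=
  (inner_coeffMul B _ _).symm

/-! ### Ellipticity -/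

/-- The exceptional null set in the definition may depend on `ξ`. A countable dense family of
vectors and continuity in `ξ` give a common one, so that `ξ` may later be replaced by `g x`. -/
theorem IsEllipticityConst.ae_forall {A : Coeff Ω} {c : ℝ} (h : IsEllipticityConst A c) :
    ∀ᵐ x ∂(volume.restrict Ω), ∀ ξ : EuclideanSpace ℂ (Fin d),
      c * ‖ξ‖ ^ 2 ≤ (inner ℂ ξ (matAct (A x) ξ)).re := by
  have h1 : ∀ᵐ x ∂(volume.restrict Ω), ∀ n : ℕ,
      c * ‖TopologicalSpace.denseSeq (EuclideanSpace ℂ (Fin d)) n‖ ^ 2 ≤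
        (inner ℂ (TopologicalSpace.denseSeq (EuclideanSpace ℂ (Fin d)) n)
          (matAct (A x) (TopologicalSpace.denseSeq (EuclideanSpace ℂ (Fin d)) n))).re :=
    ae_all_iff.2 fun n => h _
  filter_upwards [h1] with x hx ξ
  refine (TopologicalSpace.denseRange_denseSeq (EuclideanSpace ℂ (Fin d))).induction_on
    (p := fun ξ => c * ‖ξ‖ ^ 2 ≤ (inner ℂ ξ (matAct (A x) ξ)).re) ξ ?_ hx
  refine isClosed_le (by fun_prop) ?_
  exact Complex.continuous_re.comp (continuous_id.inner (matActL d (A x)).continuous)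

theorem IsEllipticityConst.le_inner {A : Coeff Ω} {c : ℝ} (h : IsEllipticityConst A c)
    (g : L2VecDom Ω) : c * ‖g‖ ^ 2 ≤ (inner ℂ g (coeffMul Ω A g)).re := by
  have hint : Integrable (fun x => inner ℂ (g x) (coeffMul Ω A g x)) (volume.restrict Ω) :=
    L2.integrable_inner _ _
  have h1 : (inner ℂ g (coeffMul Ω A g)).re =
      ∫ x in Ω, (inner ℂ (g x) (coeffMul Ω A g x)).re := by
    rw [L2.inner_def]
    exact (integral_re hint).symm
  have h2 : ‖g‖ ^ 2 = ∫ x in Ω, ‖g x‖ ^ 2 := by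
    have h3 := inner_self_eq_norm_sq (𝕜 := ℂ) g
    rw [← h3, L2.inner_def, ← integral_re (L2.integrable_inner g g)]
    simp only [inner_self_eq_norm_sq]
  rw [h1, h2, ← integral_const_mul]
  refine integral_mono_ae ((Lp.memLp g).integrable_norm_pow (by norm_num) |>.const_mul c)
    hint.re ?_
  filter_upwards [h.ae_forall, coeffMul_ae A g] with x hx hx'
  rw [hx']
  exact hx (g x)

/-- The added term is pointwise at most `‖B‖ |ξ|²` in absolute value. This yields both openness of
the elliptic set and ellipticity throughout the ball `‖B‖ < c`. -/
theorem IsEllipticityConst.add {A B : Coeff Ω} {c : ℝ} (h : IsEllipticityConst A c) :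
    IsEllipticityConst (A + B) (c - ‖B‖) := by
  intro ξ
  have hB : ∀ᵐ x ∂(volume.restrict Ω), ‖B x‖ ≤ ‖B‖ := by
    have h1 : ∀ᵐ x ∂(volume.restrict Ω), ‖B x‖ₑ ≤ eLpNormEssSup B (volume.restrict Ω) :=
      enorm_ae_le_eLpNormEssSup _ _
    have h2 : eLpNormEssSup B (volume.restrict Ω) = ‖B‖ₑ := by
      rw [Lp.enorm_def, eLpNorm_exponent_top]
    filter_upwards [h1] with x hx
    rw [h2] at hx
    exact enorm_le_iff_norm_le.1 hx
  filter_upwards [h ξ, hB, Lp.coeFn_add A B] with x h1 h2 h3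
  have h4 : inner ℂ ξ (matAct ((A + B : Coeff Ω) x) ξ) =
      inner ℂ ξ (matAct (A x) ξ) + inner ℂ ξ (matAct (B x) ξ) := by
    rw [h3, Pi.add_apply, ← matActL_apply, map_add, add_apply, inner_add_right]
    rfl
  have h5 : |(inner ℂ ξ (matAct (B x) ξ)).re| ≤ ‖B‖ * ‖ξ‖ ^ 2 := by
    refine (Complex.abs_re_le_norm _).trans ((norm_inner_le_norm _ _).trans ?_)
    have := norm_matAct_le (B x) ξ
    have h6 : ‖B x‖ * ‖ξ‖ ≤ ‖B‖ * ‖ξ‖ := by gcongr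
    nlinarith [norm_nonneg ξ]
  rw [h4, Complex.add_re]
  linarith [neg_abs_le (inner ℂ ξ (matAct (B x) ξ)).re, h5]

theorem isOpen_ellipticCoeff : IsOpen (ellipticCoeff Ω) := by
  rw [Metric.isOpen_iff]
  rintro A ⟨c, hc, hA⟩
  refine ⟨c, hc, fun A' hA' => ?_⟩
  have h := hA.add (B := A' - A)
  rw [add_sub_cancel] at h
  refine ⟨_, ?_, h⟩
  rw [Metric.mem_ball, dist_eq_norm] at hA'
  linarith

/-! ### Constants -/

/-- Integration by parts against the constant `1`; it makes `0` the weak gradient of a constant. -/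
theorem integral_fderiv_apply_eq_zero {φ : EuclideanSpace ℝ (Fin d) → ℝ} (hφ : ContDiff ℝ ∞ φ)
    (hc : HasCompactSupport φ) (v : EuclideanSpace ℝ (Fin d)) :
    ∫ x, fderiv ℝ φ x v = 0 := by
  have hd : Continuous fun x => fderiv ℝ φ x v :=
    (hφ.continuous_fderiv (by simp)).clm_apply continuous_const
  have h := integral_mul_fderiv_eq_neg_fderiv_mul_of_integrable (μ := volume)
    (f := fun _ : EuclideanSpace ℝ (Fin d) => (1 : ℝ)) (g := φ) (v := v) (by simp)
    (by simpa using hd.integrable_of_hasCompactSupport (hc.fderiv_apply (𝕜 := ℝ) v))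
    (by simpa using hφ.continuous.integrable_of_hasCompactSupport hc)
    (by simp) (fun x _ => (hφ.differentiable (by simp)).differentiableAt)
  simpa using h

/-- The constant function `c` as an element of `H^1(Ω)`. -/
noncomputable def H1.const (hΩ : volume Ω ≠ ⊤) (c : ℂ) : H1 Ω :=
  ⟨WithLp.toLp 2 (haveI : IsFiniteMeasure (volume.restrict Ω) := ⟨by simpa using hΩ.lt_top⟩
    (Lp.const 2 (volume.restrict Ω) c, 0)), by
    have : IsFiniteMeasure (volume.restrict Ω) := ⟨by simpa using hΩ.lt_top⟩
    intro φ hφ hc hs i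
    have h1 : ∫ x in Ω, (fderiv ℝ φ x (EuclideanSpace.single i 1)) •
        (Lp.const 2 (volume.restrict Ω) c : L2Dom Ω) x = 0 := by
      have h2 : ∫ x in Ω, (fderiv ℝ φ x (EuclideanSpace.single i 1)) •
          (Lp.const 2 (volume.restrict Ω) c : L2Dom Ω) x =
          ∫ x in Ω, (fderiv ℝ φ x (EuclideanSpace.single i 1)) • c := by
        refine integral_congr_ae ?_
        filter_upwards [Lp.coeFn_const 2 (volume.restrict Ω) c] with x hx
        rw [hx]; rfl
      rw [h2, integral_smul_const, setIntegral_eq_integral_of_forall_compl_eq_zero,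
        integral_fderiv_apply_eq_zero hφ hc, zero_smul]
      intro x hx
      rw [fderiv_of_notMem_tsupport ℝ (fun h => hx (hs h)), zero_apply]
    have h3 : ∫ x in Ω, φ x • (0 : L2VecDom Ω) x i = 0 := by
      refine integral_eq_zero_of_ae ?_
      filter_upwards [Lp.coeFn_zero (EuclideanSpace ℂ (Fin d)) 2 (volume.restrict Ω)] with x hx
      rw [hx]; simp
    change ∫ x in Ω, (fderiv ℝ φ x (EuclideanSpace.single i 1)) •
        (Lp.const 2 (volume.restrict Ω) c : L2Dom Ω) x = - ∫ x in Ω, φ x • (0 : L2VecDom Ω) x i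
    rw [h1, h3, neg_zero]⟩

theorem H1.grad_const (hΩ : volume Ω ≠ ⊤) (c : ℂ) : H1.grad (H1.const hΩ c) = 0 := rfl

theorem H1.toFun_const_ae (hΩ : volume Ω ≠ ⊤) (c : ℂ) :
    H1.toFun (H1.const hΩ c) =ᵐ[volume.restrict Ω] fun _ => c := by
  have : IsFiniteMeasure (volume.restrict Ω) := ⟨by simpa using hΩ.lt_top⟩
  exact Lp.coeFn_const 2 _ c

end Sobolev

/-! ### The variational problems on `H^1_⋄(Ω)` -/

section Variational

variable {d : ℕ} {Ω Γ : Set (EuclideanSpace ℝ (Fin d))}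

/-- For finite surface measure the integral is the inner product with the constant `1`, hence
continuous. -/
theorem isClosed_L2Mean [IsFiniteMeasure (surfaceMeasure Γ)] :
    IsClosed (L2Mean Γ : Set (L2Bd Γ)) := by
  have h : (L2Mean Γ : Set (L2Bd Γ)) =
      {g | inner ℂ (Lp.const 2 (surfaceMeasure Γ) (1 : ℂ)) g = 0} := by
    ext g
    have h1 : inner ℂ (Lp.const 2 (surfaceMeasure Γ) (1 : ℂ)) g =
        ∫ x, g x ∂(surfaceMeasure Γ) := by
      rw [L2.inner_def]
      refine integral_congr_ae ?_
      filter_upwards [Lp.coeFn_const 2 (surfaceMeasure Γ) (1 : ℂ)] with x hx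
      rw [hx]
      simp
    rw [Set.mem_ofPred_eq, h1]
    exact ⟨fun h => h.2, fun h => ⟨(Lp.memLp g).integrable (by norm_num), h⟩⟩
  rw [h]
  exact isClosed_eq (by fun_prop) continuous_const

theorem isClosed_H1Mean [IsFiniteMeasure (surfaceMeasure Γ)] :
    IsClosed (H1Mean Ω Γ : Set (H1 Ω)) :=
  (isClosed_L2Mean (Γ := Γ)).preimage (traceOp Ω Γ).continuous

instance [IsFiniteMeasure (surfaceMeasure Γ)] : CompleteSpace (H1Mean Ω Γ) :=
  (isClosed_H1Mean (Ω := Ω) (Γ := Γ)).completeSpace_coe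

theorem traceOp_const_ae (hT : IsTraceOp Ω Γ (traceOp Ω Γ)) (hΩ : volume Ω ≠ ⊤) (c : ℂ) :
    traceOp Ω Γ (H1.const hΩ c) =ᵐ[surfaceMeasure Γ] fun _ => c :=
  hT _ _ contDiff_const (H1.toFun_const_ae hΩ c)

/-- Every element of `H^1(Ω)` is the sum of an element of `H^1_⋄(Ω)` and a constant. -/
theorem exists_sub_const_mem_H1Mean [IsFiniteMeasure (surfaceMeasure Γ)]
    (hpos : surfaceMeasure Γ ≠ 0) (hT : IsTraceOp Ω Γ (traceOp Ω Γ)) (hΩ : volume Ω ≠ ⊤)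
    (v : H1 Ω) : ∃ c : ℂ, v - H1.const hΩ c ∈ H1Mean Ω Γ := by
  have hint : Integrable (traceOp Ω Γ v) (surfaceMeasure Γ) :=
    (Lp.memLp (traceOp Ω Γ v)).integrable (by norm_num)
  have hm : ((surfaceMeasure Γ).real Set.univ : ℂ) ≠ 0 := by
    have : (surfaceMeasure Γ).real Set.univ ≠ 0 := by
      rw [Measure.real, ENNReal.toReal_ne_zero]
      exact ⟨by simpa using hpos, measure_ne_top _ _⟩
    exact_mod_cast this
  -- The constant is the mean of the trace over `Γ`.
  refine ⟨((surfaceMeasure Γ).real Set.univ : ℂ)⁻¹ * ∫ x, traceOp Ω Γ v x ∂(surfaceMeasure Γ), ?_⟩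
  set c := ((surfaceMeasure Γ).real Set.univ : ℂ)⁻¹ * ∫ x, traceOp Ω Γ v x ∂(surfaceMeasure Γ)
    with hc
  have h1 : traceOp Ω Γ (v - H1.const hΩ c) =ᵐ[surfaceMeasure Γ]
      fun x => traceOp Ω Γ v x - c := by
    rw [map_sub]
    filter_upwards [Lp.coeFn_sub (traceOp Ω Γ v) (traceOp Ω Γ (H1.const hΩ c)),
      traceOp_const_ae hT hΩ c] with x hx hx'
    rw [hx, Pi.sub_apply, hx']
  change Integrable _ _ ∧ _
  refine ⟨(hint.sub (integrable_const c)).congr h1.symm, ?_⟩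
  change ∫ x, traceOp Ω Γ (v - H1.const hΩ c) x ∂(surfaceMeasure Γ) = 0
  rw [integral_congr_ae h1, integral_sub hint (integrable_const c), integral_const, hc,
    Complex.real_smul, mul_inv_cancel_left₀ hm, sub_self]

/-- The weak gradient on `H^1_⋄(Ω)`. -/
noncomputable def gradMean (Ω Γ : Set (EuclideanSpace ℝ (Fin d))) : H1Mean Ω Γ →L[ℂ] L2VecDom Ω :=
  (gradL Ω).comp (H1Mean Ω Γ).subtypeL

theorem gradMean_apply (w : H1Mean Ω Γ) : gradMean Ω Γ w = H1.grad (w : H1 Ω) := rfl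

variable [IsFiniteMeasure (surfaceMeasure Γ)]

/-- The operator on `H^1_⋄(Ω)` representing the form `⟨·, ·⟩_B`. -/
noncomputable def formOp (Ω Γ : Set (EuclideanSpace ℝ (Fin d)))
    [IsFiniteMeasure (surfaceMeasure Γ)] :
    Coeff Ω →L[ℂ] (H1Mean Ω Γ →L[ℂ] H1Mean Ω Γ) :=
  sandwich (gradMean Ω Γ) (coeffMul Ω)

theorem inner_formOp (B : Coeff Ω) (w v : H1Mean Ω Γ) :
    inner ℂ v (formOp Ω Γ B w) = coeffForm B (w : H1 Ω) (v : H1 Ω) := by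
  rw [coeffForm_eq_inner]
  exact inner_sandwich (gradMean Ω Γ) (coeffMul Ω) B w v

/-- The trace operator `H^1_⋄(Ω) → L^2(Γ)`. -/
noncomputable def traceOfMean (Ω Γ : Set (EuclideanSpace ℝ (Fin d))) : H1Mean Ω Γ →L[ℂ] L2Bd Γ :=
  (traceOp Ω Γ).comp (H1Mean Ω Γ).subtypeL

/-- The operator representing the functionals `v ↦ ⟨f, T v⟩`. -/
noncomputable def loadOp (Ω Γ : Set (EuclideanSpace ℝ (Fin d)))
    [IsFiniteMeasure (surfaceMeasure Γ)] : L2Mean Γ →L[ℂ] H1Mean Ω Γ :=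
  (ContinuousLinearMap.adjoint (traceOfMean Ω Γ)).comp (L2Mean Γ).subtypeL

theorem inner_loadOp (f : L2Mean Γ) (v : H1Mean Ω Γ) :
    inner ℂ v (loadOp Ω Γ f) = inner ℂ (traceOp Ω Γ (v : H1 Ω)) (f : L2Bd Γ) :=
  ContinuousLinearMap.adjoint_inner_right (traceOfMean Ω Γ) v (f : L2Bd Γ)

theorem coeffForm_sub_const (hΩ : volume Ω ≠ ⊤) (B : Coeff Ω) (w v : H1 Ω) (c : ℂ) :
    coeffForm B w (v - H1.const hΩ c) = coeffForm B w v := by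
  have h : H1.grad (v - H1.const hΩ c) = H1.grad v := by
    rw [← gradL_apply, map_sub, gradL_apply (H1.const hΩ c), H1.grad_const, sub_zero, gradL_apply]
  rw [coeffForm_eq_inner, coeffForm_eq_inner, h]

/-- Representing operators see only test functions in `H1Mean Ω Γ`. Subtracting a constant from a
general `v` changes neither side: the form sees only `∇v`, and `f` has mean zero. -/
theorem isWeakSolution_iff (hpos : surfaceMeasure Γ ≠ 0) (hT : IsTraceOp Ω Γ (traceOp Ω Γ))
    (hΩ : volume Ω ≠ ⊤) (A : Coeff Ω) (f : L2Mean Γ) (u : H1Mean Ω Γ) :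
    IsWeakSolution A f u ↔ formOp Ω Γ A u = loadOp Ω Γ f := by
  constructor
  · intro h
    refine ext_inner_left ℂ fun v => ?_
    rw [inner_formOp, inner_loadOp]
    exact h v
  · intro h v
    obtain ⟨c, hc⟩ := exists_sub_const_mem_H1Mean hpos hT hΩ v
    have h1 := inner_formOp A u ⟨_, hc⟩
    rw [h, inner_loadOp] at h1
    have h3 : inner ℂ (traceOp Ω Γ (H1.const hΩ c)) (f : L2Bd Γ) = 0 := by
      rw [L2.inner_def]
      have h4 : ∫ x, inner ℂ (traceOp Ω Γ (H1.const hΩ c) x) ((f : L2Bd Γ) x) ∂(surfaceMeasure Γ) =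
          ∫ x, (starRingEnd ℂ c) • (f : L2Bd Γ) x ∂(surfaceMeasure Γ) := by
        refine integral_congr_ae ?_
        filter_upwards [traceOp_const_ae hT hΩ c] with x hx
        rw [hx, RCLike.inner_apply, smul_eq_mul, mul_comm]
      rw [h4, integral_smul, f.2.2, smul_zero]
    rw [← coeffForm_sub_const hΩ A u v c, ← h1]
    change inner ℂ (traceOp Ω Γ (v - H1.const hΩ c)) _ = _
    rw [map_sub, inner_sub_left, h3, sub_zero]

theorem isPerturbSolution_iff (hpos : surfaceMeasure Γ ≠ 0) (hT : IsTraceOp Ω Γ (traceOp Ω Γ))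
    (hΩ : volume Ω ≠ ⊤) (A B : Coeff Ω) (y z : H1Mean Ω Γ) :
    IsPerturbSolution A B y z ↔ formOp Ω Γ A z = - formOp Ω Γ B y := by
  constructor
  · intro h
    refine ext_inner_left ℂ fun v => ?_
    rw [inner_formOp, inner_neg_right, inner_formOp]
    exact h v
  · intro h v
    obtain ⟨c, hc⟩ := exists_sub_const_mem_H1Mean hpos hT hΩ v
    have h1 := inner_formOp A z ⟨_, hc⟩
    rw [h, inner_neg_right, inner_formOp] at h1
    rw [← coeffForm_sub_const hΩ A z v c, ← coeffForm_sub_const hΩ B y v c]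
    exact h1.symm

theorem isUnit_formOp {C : ℝ} (hC : ∀ w : H1Mean Ω Γ, ‖w‖ ^ 2 ≤ C * ‖H1.grad (w : H1 Ω)‖ ^ 2)
    {A : Coeff Ω} {c : ℝ} (hc : 0 < c) (hA : IsEllipticityConst A c) :
    IsUnit (formOp Ω Γ A) := by
  -- The coercivity constant is `c / (|C| + 1)`, positive whatever the sign of `C`.
  have hC1 : 0 < |C| + 1 := by positivity
  refine isUnit_of_coercive _ (div_pos hc hC1) fun u => ?_
  rw [inner_formOp, coeffForm_eq_inner]
  refine le_trans ?_ (hA.le_inner _)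
  rw [div_mul_eq_mul_div, div_le_iff₀ hC1, mul_assoc]
  refine mul_le_mul_of_nonneg_left ((hC u).trans ?_) hc.le
  nlinarith [le_abs_self C, sq_nonneg ‖H1.grad (u : H1 Ω)‖]

/-- `B ↦ -(M A)⁻¹ (M B)`. -/
noncomputable def perturbFormOp (Ω Γ : Set (EuclideanSpace ℝ (Fin d)))
    [IsFiniteMeasure (surfaceMeasure Γ)] (A : Coeff Ω) :
    Coeff Ω →L[ℂ] (H1Mean Ω Γ →L[ℂ] H1Mean Ω Γ) :=
  negInverseMul (formOp Ω Γ) (formOp Ω Γ A)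

theorem perturbFormOp_apply (A B : Coeff Ω) :
    perturbFormOp Ω Γ A B = -(Ring.inverse (formOp Ω Γ A) * formOp Ω Γ B) := rfl

/-- The explicit operator shows that the property defining the choice is satisfiable, and uniqueness
of solutions identifies the chosen operator with it. -/
theorem solOp_eq
    (hpos : surfaceMeasure Γ ≠ 0) (hT : IsTraceOp Ω Γ (traceOp Ω Γ)) (hΩ : volume Ω ≠ ⊤)
    {C : ℝ} (hC : ∀ w : H1Mean Ω Γ, ‖w‖ ^ 2 ≤ C * ‖H1.grad (w : H1 Ω)‖ ^ 2)
    {A : Coeff Ω} (hA : A ∈ ellipticCoeff Ω) :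
    solOp Ω Γ A = Ring.inverse (formOp Ω Γ A) ∘L loadOp Ω Γ := by
  obtain ⟨c, hc, hAc⟩ := hA
  have hu := isUnit_formOp hC hc hAc
  have hex : ∀ f : L2Mean Γ,
      IsWeakSolution A f ((Ring.inverse (formOp Ω Γ A) ∘L loadOp Ω Γ) f) := fun f =>
    (isWeakSolution_iff hpos hT hΩ A f _).2 ((apply_eq_iff_eq_inverse_apply hu _ _).2 rfl)
  have hspec := Classical.epsilon_spec
    (p := fun S : L2Mean Γ →L[ℂ] H1Mean Ω Γ => ∀ f, IsWeakSolution A f (S f)) ⟨_, hex⟩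
  ext1 f
  exact (apply_eq_iff_eq_inverse_apply hu _ _).1
    ((isWeakSolution_iff hpos hT hΩ A f _).1 (hspec f))

theorem perturbOp_eq
    (hpos : surfaceMeasure Γ ≠ 0) (hT : IsTraceOp Ω Γ (traceOp Ω Γ)) (hΩ : volume Ω ≠ ⊤)
    {C : ℝ} (hC : ∀ w : H1Mean Ω Γ, ‖w‖ ^ 2 ≤ C * ‖H1.grad (w : H1 Ω)‖ ^ 2)
    {A : Coeff Ω} (hA : A ∈ ellipticCoeff Ω) :
    perturbOp Ω Γ A = perturbFormOp Ω Γ A := by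
  obtain ⟨c, hc, hAc⟩ := hA
  have hu := isUnit_formOp hC hc hAc
  have key : ∀ (B : Coeff Ω) (y z : H1Mean Ω Γ),
      IsPerturbSolution A B y z ↔ z = perturbFormOp Ω Γ A B y := fun B y z => by
    rw [isPerturbSolution_iff hpos hT hΩ, apply_eq_iff_eq_inverse_apply hu, map_neg]
    rfl
  have hspec := Classical.epsilon_spec
    (p := fun P : Coeff Ω →L[ℂ] (H1Mean Ω Γ →L[ℂ] H1Mean Ω Γ) =>
      ∀ B y, IsPerturbSolution A B y (P B y)) ⟨_, fun B y => (key B y _).2 rfl⟩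
  ext1 B
  ext1 y
  exact (key B y _).1 (hspec B y)

theorem isWeakSolution_iff_eq_solOp
    (hpos : surfaceMeasure Γ ≠ 0) (hT : IsTraceOp Ω Γ (traceOp Ω Γ)) (hΩ : volume Ω ≠ ⊤)
    {C : ℝ} (hC : ∀ w : H1Mean Ω Γ, ‖w‖ ^ 2 ≤ C * ‖H1.grad (w : H1 Ω)‖ ^ 2)
    {A : Coeff Ω} (hA : A ∈ ellipticCoeff Ω) (f : L2Mean Γ)
    (u : H1Mean Ω Γ) : IsWeakSolution A f u ↔ u = solOp Ω Γ A f := by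
  rw [solOp_eq hpos hT hΩ hC hA]
  obtain ⟨c, hc, hAc⟩ := hA
  rw [isWeakSolution_iff hpos hT hΩ, apply_eq_iff_eq_inverse_apply (isUnit_formOp hC hc hAc)]
  rfl

theorem isPerturbSolution_iff_eq_perturbOp
    (hpos : surfaceMeasure Γ ≠ 0) (hT : IsTraceOp Ω Γ (traceOp Ω Γ)) (hΩ : volume Ω ≠ ⊤)
    {C : ℝ} (hC : ∀ w : H1Mean Ω Γ, ‖w‖ ^ 2 ≤ C * ‖H1.grad (w : H1 Ω)‖ ^ 2)
    {A : Coeff Ω} (hA : A ∈ ellipticCoeff Ω) (B : Coeff Ω)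
    (y z : H1Mean Ω Γ) : IsPerturbSolution A B y z ↔ z = perturbOp Ω Γ A B y := by
  rw [perturbOp_eq hpos hT hΩ hC hA]
  obtain ⟨c, hc, hAc⟩ := hA
  rw [isPerturbSolution_iff hpos hT hΩ, apply_eq_iff_eq_inverse_apply (isUnit_formOp hC hc hAc),
    map_neg]
  rfl

/-- The resolvent identity from which all the expansions follow. It holds for every `B` with `A + B`
elliptic, with no smallness condition. -/
theorem solOp_add_eq
    (hpos : surfaceMeasure Γ ≠ 0) (hT : IsTraceOp Ω Γ (traceOp Ω Γ)) (hΩ : volume Ω ≠ ⊤)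
    {C : ℝ} (hC : ∀ w : H1Mean Ω Γ, ‖w‖ ^ 2 ≤ C * ‖H1.grad (w : H1 Ω)‖ ^ 2)
    {A B : Coeff Ω} (hA : A ∈ ellipticCoeff Ω) (hAB : A + B ∈ ellipticCoeff Ω) :
    solOp Ω Γ (A + B) = Ring.inverse (1 - perturbOp Ω Γ A B) ∘L solOp Ω Γ A := by
  rw [solOp_eq hpos hT hΩ hC hAB, solOp_eq hpos hT hΩ hC hA, perturbOp_eq hpos hT hΩ hC hA,
    perturbFormOp_apply]
  obtain ⟨c, hc, hAc⟩ := hA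
  rw [inverse_add_eq (formOp Ω Γ) A B (isUnit_formOp hC hc hAc)]
  rfl

theorem eventually_solOp_eq
    (hpos : surfaceMeasure Γ ≠ 0) (hT : IsTraceOp Ω Γ (traceOp Ω Γ)) (hΩ : volume Ω ≠ ⊤)
    {C : ℝ} (hC : ∀ w : H1Mean Ω Γ, ‖w‖ ^ 2 ≤ C * ‖H1.grad (w : H1 Ω)‖ ^ 2)
    {A : Coeff Ω} (hA : A ∈ ellipticCoeff Ω) :
    ∀ᶠ A' in nhds A,
      solOp Ω Γ A' = Ring.inverse (1 - perturbOp Ω Γ A (A' - A)) ∘L solOp Ω Γ A := by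
  filter_upwards [isOpen_ellipticCoeff.mem_nhds hA] with A' hA'
  have h := solOp_add_eq hpos hT hΩ hC (B := A' - A) hA (by rwa [add_sub_cancel])
  rwa [add_sub_cancel] at h

theorem analyticOnNhd_solOp
    (hpos : surfaceMeasure Γ ≠ 0) (hT : IsTraceOp Ω Γ (traceOp Ω Γ)) (hΩ : volume Ω ≠ ⊤)
    {C : ℝ} (hC : ∀ w : H1Mean Ω Γ, ‖w‖ ^ 2 ≤ C * ‖H1.grad (w : H1 Ω)‖ ^ 2) : AnalyticOnNhd ℂ (solOp Ω Γ) (ellipticCoeff Ω) := fun _ hA =>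
  (hasFPowerSeriesAt_neumannSeries _ _ (eventually_solOp_eq hpos hT hΩ hC hA)).analyticAt

theorem analyticOnNhd_ndMap
    (hpos : surfaceMeasure Γ ≠ 0) (hT : IsTraceOp Ω Γ (traceOp Ω Γ)) (hΩ : volume Ω ≠ ⊤)
    {C : ℝ} (hC : ∀ w : H1Mean Ω Γ, ‖w‖ ^ 2 ≤ C * ‖H1.grad (w : H1 Ω)‖ ^ 2) : AnalyticOnNhd ℂ (ndMap Ω Γ) (ellipticCoeff Ω) := fun A hA =>
  (analyticOnNhd_solOp hpos hT hΩ hC A hA).clm_comp_left (traceMean Ω Γ)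

theorem iteratedFDeriv_ndMap
    (hpos : surfaceMeasure Γ ≠ 0) (hT : IsTraceOp Ω Γ (traceOp Ω Γ)) (hΩ : volume Ω ≠ ⊤)
    {C : ℝ} (hC : ∀ w : H1Mean Ω Γ, ‖w‖ ^ 2 ≤ C * ‖H1.grad (w : H1 Ω)‖ ^ 2)
    {A : Coeff Ω} (hA : A ∈ ellipticCoeff Ω) (k : ℕ)
    (B : Fin k → Coeff Ω) :
    iteratedFDeriv ℂ k (ndMap Ω Γ) A B =
      traceMean Ω Γ ∘L iteratedFDeriv ℂ k (solOp Ω Γ) A B :=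
  iteratedFDeriv_clm_comp_left (analyticOnNhd_solOp hpos hT hΩ hC A hA) (traceMean Ω Γ) k B

/-- Testing the equation for `z = P_A(B) y` with `z` itself gives `c ‖∇z‖² ≤ ‖B‖ ‖∇y‖ ‖∇z‖`. The
Poincaré constant does not enter the factor, which is why the series converges for all `‖B‖ < c`. -/
theorem norm_grad_perturbOp_le
    (hpos : surfaceMeasure Γ ≠ 0) (hT : IsTraceOp Ω Γ (traceOp Ω Γ)) (hΩ : volume Ω ≠ ⊤)
    {C : ℝ} (hC : ∀ w : H1Mean Ω Γ, ‖w‖ ^ 2 ≤ C * ‖H1.grad (w : H1 Ω)‖ ^ 2)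
    {A B : Coeff Ω} {c : ℝ} (hc : 0 < c) (hA : IsEllipticityConst A c)
    (y : H1Mean Ω Γ) :
    ‖gradMean Ω Γ (perturbOp Ω Γ A B y)‖ ≤ ‖B‖ / c * ‖gradMean Ω Γ y‖ := by
  set z := perturbOp Ω Γ A B y with hz
  have h := (isPerturbSolution_iff_eq_perturbOp hpos hT hΩ hC ⟨c, hc, hA⟩ B y z).2 hz z
  rw [coeffForm_eq_inner, coeffForm_eq_inner] at h
  have h1 := hA.le_inner (H1.grad (z : H1 Ω))
  have h2 : (inner ℂ (H1.grad (z : H1 Ω)) (coeffMul Ω A (H1.grad (z : H1 Ω)))).re ≤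
      ‖H1.grad (z : H1 Ω)‖ * (‖B‖ * ‖H1.grad (y : H1 Ω)‖) := by
    refine (Complex.re_le_norm _).trans ?_
    rw [h, norm_neg]
    refine (norm_inner_le_norm _ _).trans ?_
    gcongr
    exact norm_coeffMul_apply_le _ _
  rw [gradMean_apply, gradMean_apply]
  rcases (norm_nonneg (H1.grad (z : H1 Ω))).eq_or_lt with h0 | h0
  · rw [← h0]; positivity
  · rw [div_mul_eq_mul_div, le_div_iff₀ hc]
    nlinarith

theorem hasSum_perturbOp_pow
    (hpos : surfaceMeasure Γ ≠ 0) (hT : IsTraceOp Ω Γ (traceOp Ω Γ)) (hΩ : volume Ω ≠ ⊤)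
    {C : ℝ} (hC : ∀ w : H1Mean Ω Γ, ‖w‖ ^ 2 ≤ C * ‖H1.grad (w : H1 Ω)‖ ^ 2)
    {A B : Coeff Ω} {c : ℝ} (hc : 0 < c) (hA : IsEllipticityConst A c)
    (hB : ‖B‖ < c) :
    HasSum (fun k : ℕ => (perturbOp Ω Γ A B ^ k) ∘L solOp Ω Γ A) (solOp Ω Γ (A + B)) := by
  rw [solOp_add_eq hpos hT hΩ hC ⟨c, hc, hA⟩ ⟨_, sub_pos.2 hB, hA.add⟩]
  exact hasSum_pow_comp (summable_pow_of_contractive (gradMean Ω Γ) (perturbOp Ω Γ A B) hC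
    (by positivity) ((div_lt_one hc).2 hB) (norm_grad_perturbOp_le hpos hT hΩ hC hc hA)) _

theorem inv_factorial_smul_iteratedFDeriv_solOp
    (hpos : surfaceMeasure Γ ≠ 0) (hT : IsTraceOp Ω Γ (traceOp Ω Γ)) (hΩ : volume Ω ≠ ⊤)
    {C : ℝ} (hC : ∀ w : H1Mean Ω Γ, ‖w‖ ^ 2 ≤ C * ‖H1.grad (w : H1 Ω)‖ ^ 2)
    {A : Coeff Ω} (hA : A ∈ ellipticCoeff Ω)
    (B : Coeff Ω) (k : ℕ) :
    ((k.factorial : ℂ)⁻¹) • iteratedFDeriv ℂ k (solOp Ω Γ) A (fun _ => B) =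
      (perturbOp Ω Γ A B ^ k) ∘L solOp Ω Γ A :=
  inv_factorial_smul_iteratedFDeriv _ _ (eventually_solOp_eq hpos hT hΩ hC hA) k B

end Variational

/-! ### Translation estimate for functions with a weak gradient -/

section Translation

variable {d : ℕ}

/-- Smooth functions with compact support in `S`, as a subspace of `L^2(S)`. -/
noncomputable def testSubmodule (S : Set (EuclideanSpace ℝ (Fin d))) :
    Submodule ℝ (Lp ℝ 2 (volume.restrict S)) where
  carrier := {g | ∃ ψ : EuclideanSpace ℝ (Fin d) → ℝ, ContDiff ℝ ∞ ψ ∧ HasCompactSupport ψ ∧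
    tsupport ψ ⊆ S ∧ g =ᵐ[volume.restrict S] ψ}
  zero_mem' := ⟨0, contDiff_const, HasCompactSupport.zero, by simp [tsupport], Lp.coeFn_zero _ _ _⟩
  add_mem' := by
    rintro f g ⟨φ, h1, h2, h3, h4⟩ ⟨ψ, k1, k2, k3, k4⟩
    exact ⟨φ + ψ, h1.add k1, h2.add k2,
      (tsupport_add φ ψ).trans (Set.union_subset h3 k3),
      (Lp.coeFn_add f g).trans (h4.add k4)⟩
  smul_mem' := by
    rintro c f ⟨φ, h1, h2, h3, h4⟩
    exact ⟨c • φ, h1.const_smul c, h2.smul_left (f := fun _ => c),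
      (closure_mono (Function.support_const_smul_subset c φ)).trans h3,
      (Lp.coeFn_smul c f).trans (h4.const_smul c)⟩

/-- By the fundamental lemma of the calculus of variations, a function orthogonal to all test
functions on `S` vanishes almost everywhere. -/
theorem dense_testSubmodule {S : Set (EuclideanSpace ℝ (Fin d))} (hS : IsOpen S) :
    (testSubmodule S).topologicalClosure = ⊤ := by
  rw [Submodule.topologicalClosure_eq_top_iff, Submodule.eq_bot_iff]
  intro f hf
  have hloc : LocallyIntegrableOn f S volume :=
    locallyIntegrableOn_of_locallyIntegrable_restrict
      ((Lp.memLp f).locallyIntegrable (by norm_num))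
  have h := hS.ae_eq_zero_of_integral_contDiff_smul_eq_zero hloc ?_
  · rw [Lp.eq_zero_iff_ae_eq_zero]
    exact (ae_restrict_iff' hS.measurableSet).2 h
  · intro ψ h1 h2 h3
    have hmem := (h1.continuous.memLp_of_hasCompactSupport (p := 2) (μ := volume) h2).restrict S
    have h4 := (Submodule.mem_orthogonal _ _).1 hf (hmem.toLp ψ) ⟨ψ, h1, h2, h3, hmem.coeFn_toLp⟩
    rw [L2.inner_def] at h4
    rw [← setIntegral_eq_integral_of_forall_compl_eq_zero (s := S), ← h4]
    · refine integral_congr_ae ?_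
      filter_upwards [hmem.coeFn_toLp] with x hx
      rw [hx]
      simp [mul_comm]
    · intro x hx
      rw [image_eq_zero_of_notMem_tsupport fun h => hx (h3 h), zero_smul]

/-- The `L^2` norm on an open set is detected by smooth functions with compact support. -/
theorem eLpNorm_le_of_forall_test {S : Set (EuclideanSpace ℝ (Fin d))} (hS : IsOpen S)
    {f : EuclideanSpace ℝ (Fin d) → ℝ} (hf : MemLp f 2 (volume.restrict S)) {M : ℝ} (hM : 0 ≤ M)
    (h : ∀ ψ : EuclideanSpace ℝ (Fin d) → ℝ, ContDiff ℝ ∞ ψ → HasCompactSupport ψ →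
      tsupport ψ ⊆ S → |∫ x in S, ψ x * f x| ≤ M * (eLpNorm ψ 2 (volume.restrict S)).toReal) :
    eLpNorm f 2 (volume.restrict S) ≤ ENNReal.ofReal M := by
  have key : ∀ g : Lp ℝ 2 (volume.restrict S), |inner ℝ g (hf.toLp f)| ≤ M * ‖g‖ := by
    have hcl : IsClosed {g : Lp ℝ 2 (volume.restrict S) | |inner ℝ g (hf.toLp f)| ≤ M * ‖g‖} :=
      isClosed_le (by fun_prop) (by fun_prop)
    have hsub : ((testSubmodule S : Submodule ℝ (Lp ℝ 2 (volume.restrict S))) : Set _) ⊆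
        {g : Lp ℝ 2 (volume.restrict S) | |inner ℝ g (hf.toLp f)| ≤ M * ‖g‖} := by
      rintro g ⟨ψ, h1, h2, h3, h4⟩
      have h5 := h ψ h1 h2 h3
      have h6 : inner ℝ g (hf.toLp f) = ∫ x in S, ψ x * f x := by
        rw [L2.inner_def]
        refine integral_congr_ae ?_
        filter_upwards [h4, hf.coeFn_toLp] with x hx hx'
        rw [hx, hx']
        simp [mul_comm]
      rw [Set.mem_ofPred_eq, h6, Lp.norm_def, eLpNorm_congr_ae h4]
      exact h5
    intro g
    have hg : g ∈ (testSubmodule S).topologicalClosure := by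
      rw [dense_testSubmodule hS]; trivial
    exact closure_minimal hsub hcl hg
  -- Density allows pairing `f` with itself, which turns the bound on the functional into a bound on
  -- the norm.
  have h1 := key (hf.toLp f)
  rw [real_inner_self_eq_norm_sq, abs_of_nonneg (sq_nonneg _)] at h1
  have h2 : ‖hf.toLp f‖ ≤ M := by
    rcases (norm_nonneg (hf.toLp f)).eq_or_lt with h0 | h0
    · rw [← h0]; exact hM
    · exact le_of_mul_le_mul_right (by nlinarith) h0
  rw [Lp.norm_toLp] at h2
  exact (ENNReal.le_ofReal_iff_toReal_le hf.2.ne hM).2 h2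

variable {Ω : Set (EuclideanSpace ℝ (Fin d))}

/-- The directional derivative `v · g` of a function with weak gradient `g`. -/
noncomputable def dirDeriv (v : EuclideanSpace ℝ (Fin d))
    (g : EuclideanSpace ℝ (Fin d) → EuclideanSpace ℂ (Fin d))
    (x : EuclideanSpace ℝ (Fin d)) : ℂ := ∑ i, (v i) • g x i

theorem norm_dirDeriv_le (v : EuclideanSpace ℝ (Fin d))
    (g : EuclideanSpace ℝ (Fin d) → EuclideanSpace ℂ (Fin d)) (x : EuclideanSpace ℝ (Fin d)) :
    ‖dirDeriv v g x‖ ≤ ‖v‖ * ‖g x‖ := by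
  refine (norm_sum_le _ _).trans ?_
  simp only [norm_smul]
  rw [EuclideanSpace.norm_eq, EuclideanSpace.norm_eq]
  exact Real.sum_mul_le_sqrt_mul_sqrt _ _ _

theorem IsWeakGradient.integral_fderiv_smul {u : L2Dom Ω} {g : L2VecDom Ω}
    (h : IsWeakGradient u g) {φ : EuclideanSpace ℝ (Fin d) → ℝ} (hφ : ContDiff ℝ ∞ φ)
    (hc : HasCompactSupport φ) (hs : tsupport φ ⊆ Ω) (v : EuclideanSpace ℝ (Fin d)) :
    ∫ x in Ω, (fderiv ℝ φ x v) • u x = - ∫ x in Ω, φ x • dirDeriv v g x := by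
  have h1 : ∀ x, (fderiv ℝ φ x v) • u x =
      ∑ i, (v i) • ((fderiv ℝ φ x (EuclideanSpace.single i 1)) • u x) := by
    intro x
    have hv : v = ∑ i, v i • EuclideanSpace.single i (1 : ℝ) := by
      conv_lhs => rw [← (EuclideanSpace.basisFun (Fin d) ℝ).sum_repr v]
      simp
    conv_lhs => rw [hv]
    rw [map_sum, Finset.sum_smul]
    simp [map_smul, mul_assoc]
  have hd : ∀ i, Continuous fun x => fderiv ℝ φ x (EuclideanSpace.single i (1 : ℝ)) := fun i =>
    (hφ.continuous_fderiv (by simp)).clm_apply continuous_const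
  have h2 : ∀ x, φ x • dirDeriv v g x = ∑ i, (v i) • (φ x • g x i) := by
    intro x
    rw [dirDeriv, Finset.smul_sum]
    exact Finset.sum_congr rfl fun i _ => smul_comm _ _ _
  simp only [h1, h2]
  rw [integral_finsetSum, integral_finsetSum, ← Finset.sum_neg_distrib]
  · refine Finset.sum_congr rfl fun i _ => ?_
    rw [integral_smul, integral_smul, h φ hφ hc hs i, smul_neg]
  · exact fun i _ => (integrable_smul_L2Dom hφ.continuous hc (memLp_coord g i)).smul (v i)
  · exact fun i _ =>
      (integrable_smul_L2Dom (hd i) (hc.fderiv_apply (𝕜 := ℝ) _) (Lp.memLp u)).smul (v i)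

theorem norm_integral_smul_dirDeriv_le {g : L2VecDom Ω} {φ : EuclideanSpace ℝ (Fin d) → ℝ}
    (hφ : Continuous φ) (hc : HasCompactSupport φ) (v : EuclideanSpace ℝ (Fin d)) :
    ‖∫ x in Ω, φ x • dirDeriv v g x‖ ≤ ‖v‖ * ‖g‖ * (eLpNorm φ 2 volume).toReal := by
  have hm := hφ.memLp_of_hasCompactSupport (p := 2) (μ := volume) hc
  have hmr := hm.restrict Ω
  have h1 : ‖∫ x in Ω, φ x • dirDeriv v g x‖ₑ ≤
      ‖v‖ₑ * (eLpNorm φ 2 volume * eLpNorm g 2 (volume.restrict Ω)) := by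
    calc ‖∫ x in Ω, φ x • dirDeriv v g x‖ₑ ≤ ∫⁻ x in Ω, ‖φ x • dirDeriv v g x‖ₑ :=
          enorm_integral_le_lintegral_enorm _
      _ ≤ ∫⁻ x in Ω, ‖v‖ₑ * ‖(φ • (g : EuclideanSpace ℝ (Fin d) → _)) x‖ₑ := by
          refine lintegral_mono fun x => ?_
          rw [← enorm_norm v, ← enorm_norm ((φ • (g : EuclideanSpace ℝ (Fin d) → _)) x), ← enorm_mul]
          refine enorm_le_iff_norm_le.2 ?_
          rw [norm_smul, norm_mul, norm_norm, norm_norm, Pi.smul_apply', norm_smul]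
          have := norm_dirDeriv_le v g x
          have := mul_le_mul_of_nonneg_left this (norm_nonneg (φ x))
          linarith
      _ = ‖v‖ₑ * eLpNorm (φ • (g : EuclideanSpace ℝ (Fin d) → _)) 1 (volume.restrict Ω) := by
          rw [lintegral_const_mul' _ _ enorm_ne_top, eLpNorm_one_eq_lintegral_enorm]
      _ ≤ ‖v‖ₑ * (eLpNorm φ 2 (volume.restrict Ω) * eLpNorm g 2 (volume.restrict Ω)) := by
          gcongr
          exact eLpNorm_smul_le_mul_eLpNorm (Lp.aestronglyMeasurable g) hmr.1
      _ ≤ _ := by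
          gcongr
          exact Measure.restrict_le_self
  have h2 := ENNReal.toReal_mono (ENNReal.mul_ne_top enorm_ne_top
    (ENNReal.mul_ne_top hm.2.ne (Lp.memLp g).2.ne)) h1
  rw [ENNReal.toReal_mul, ENNReal.toReal_mul, toReal_enorm, toReal_enorm, ← Lp.norm_def] at h2
  linarith

/-- Translating a test function along a segment changes its pairing with a function `u` by at
most the length of the segment times the norm of the weak gradient of `u`. -/
theorem IsWeakGradient.norm_integral_translate_le (hΩ : MeasurableSet Ω) {u : L2Dom Ω}
    {g : L2VecDom Ω} (h : IsWeakGradient u g) {S : Set (EuclideanSpace ℝ (Fin d))}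
    {v : EuclideanSpace ℝ (Fin d)}
    (hS : ∀ x ∈ S, ∀ t ∈ Set.Icc (0 : ℝ) 1, x + t • v ∈ Ω)
    {ψ : EuclideanSpace ℝ (Fin d) → ℝ} (hψ : ContDiff ℝ ∞ ψ) (hc : HasCompactSupport ψ)
    (hs : tsupport ψ ⊆ S) :
    ‖∫ x in S, ψ x • (u (x + v) - u x)‖ ≤ ‖v‖ * ‖g‖ * (eLpNorm ψ 2 volume).toReal := by
  set U : EuclideanSpace ℝ (Fin d) → ℂ := Ω.indicator u with hU
  have hU2 : MemLp U 2 volume := (memLp_indicator_iff_restrict hΩ).2 (Lp.memLp u)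
  have hUloc : LocallyIntegrable U volume := hU2.locallyIntegrable (by norm_num)
  set ρ : EuclideanSpace ℝ (Fin d) → ℝ := fun z => ψ (-z) with hρ
  have hρd : ContDiff ℝ ∞ ρ := hψ.comp contDiff_neg
  have hρc : HasCompactSupport ρ := hc.comp_homeomorph (Homeomorph.neg _)
  let L : ℂ →L[ℝ] ℝ →L[ℝ] ℂ := (ContinuousLinearMap.lsmul ℝ ℝ : ℝ →L[ℝ] ℂ →L[ℝ] ℂ).flip
  -- The pairing of `U` with the translate of `ψ` by `t • v`, written as a convolution with the
  -- reflected `ψ` so that it can be differentiated in `t` although `U` is not smooth.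
  set a : ℝ → ℂ := fun t => convolution U ρ L volume (t • v) with ha
  have ha_eq : ∀ t, a t = ∫ x, ψ (x - t • v) • U x := by
    intro t
    refine integral_congr_ae (Filter.Eventually.of_forall fun x => ?_)
    change ψ (-(t • v - x)) • U x = _
    rw [neg_sub]
  have hderiv : ∀ t : ℝ, HasDerivAt a
      ((convolution U (fderiv ℝ ρ) (L.precompR (EuclideanSpace ℝ (Fin d))) volume (t • v)) v) t := by
    intro t
    have h1 := hρc.hasFDerivAt_convolution_right L hUloc (hρd.of_le (by simp)) (t • v)
    have h2 : HasDerivAt (fun t : ℝ => t • v) v t := by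
      simpa using (hasDerivAt_id t).smul_const v
    exact h1.comp_hasDerivAt t h2
  have hbound : ∀ t ∈ Set.Icc (0 : ℝ) 1,
      ‖(convolution U (fderiv ℝ ρ) (L.precompR (EuclideanSpace ℝ (Fin d))) volume (t • v)) v‖ ≤
        ‖v‖ * ‖g‖ * (eLpNorm ψ 2 volume).toReal := by
    intro t ht
    set φ : EuclideanSpace ℝ (Fin d) → ℝ := fun x => ψ (x - t • v) with hφ
    have hφd : ContDiff ℝ ∞ φ := hψ.comp (contDiff_id.sub contDiff_const)
    have hφc : HasCompactSupport φ := hc.comp_homeomorph (Homeomorph.subRight (t • v))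
    -- The segment hypothesis keeps every intermediate translate supported in `Ω`, so the weak
    -- gradient may be tested against it.
    have hφs : tsupport φ ⊆ Ω := by
      intro x hx
      have h1 : x - t • v ∈ tsupport ψ :=
        tsupport_comp_subset_preimage ψ (Homeomorph.subRight (t • v)).continuous hx
      have h2 := hS _ (hs h1) t ht
      rwa [sub_add_cancel] at h2
    have hint : Integrable (fun x => L.precompR (EuclideanSpace ℝ (Fin d)) (U x)
        (fderiv ℝ ρ (t • v - x))) volume :=
      (hρc.fderiv ℝ).convolutionExists_right _ hUloc (hρd.continuous_fderiv (by simp)) (t • v)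
    have h1 : (convolution U (fderiv ℝ ρ) (L.precompR (EuclideanSpace ℝ (Fin d))) volume
        (t • v)) v = ∫ x in Ω, φ x • dirDeriv v g x := by
      rw [convolution_def, ContinuousLinearMap.integral_apply hint,
        show ∫ x in Ω, φ x • dirDeriv v g x = - ∫ x in Ω, (fderiv ℝ φ x v) • u x by
          rw [h.integral_fderiv_smul hφd hφc hφs v, neg_neg], ← integral_neg,
        ← integral_indicator hΩ]
      refine integral_congr_ae (Filter.Eventually.of_forall fun x => ?_)
      change fderiv ℝ ρ (t • v - x) v • U x = _
      have h2 : fderiv ℝ ρ (t • v - x) v = -(fderiv ℝ φ x v) := by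
        have h3 : HasFDerivAt ρ ((fderiv ℝ ψ (-(t • v - x))).comp
            (-ContinuousLinearMap.id ℝ (EuclideanSpace ℝ (Fin d)))) (t • v - x) :=
          ((hψ.differentiable (by simp)).differentiableAt.hasFDerivAt).comp _
            (hasFDerivAt_id _).neg
        have h4 : HasFDerivAt φ ((fderiv ℝ ψ (x - t • v)).comp
            (ContinuousLinearMap.id ℝ (EuclideanSpace ℝ (Fin d)))) x :=
          ((hψ.differentiable (by simp)).differentiableAt.hasFDerivAt).comp _
            ((hasFDerivAt_id _).sub_const _)
        rw [h3.fderiv, h4.fderiv, neg_sub]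
        simp
      rw [h2, hU]
      by_cases hx : x ∈ Ω
      · simp [hx]
      · simp [hx]
    rw [h1]
    have h3 : eLpNorm φ 2 volume = eLpNorm ψ 2 volume :=
      eLpNorm_comp_measurePreserving hψ.continuous.aestronglyMeasurable
        (measurePreserving_sub_right volume (t • v))
    rw [← h3]
    exact norm_integral_smul_dirDeriv_le hφd.continuous hφc v
  have hmvt := norm_image_sub_le_of_norm_deriv_le_segment_01'
    (fun t _ => (hderiv t).hasDerivWithinAt) (fun t ht => hbound t ⟨ht.1, ht.2.le⟩)
  have hi : ∀ y, Integrable (fun x => ψ x • U (x + y)) volume := by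
    intro y
    have hUy : MemLp (fun x => U (x + y)) 2 volume :=
      hU2.comp_measurePreserving (measurePreserving_add_right volume y)
    exact memLp_one_iff_integrable.1
      (hUy.smul (hψ.continuous.memLp_of_hasCompactSupport (p := 2) (μ := volume) hc))
  have h1 : a 1 - a 0 = ∫ x in S, ψ x • (u (x + v) - u x) := by
    have h2 : a 1 = ∫ x, ψ x • U (x + v) := by
      rw [ha_eq, ← integral_add_right_eq_self _ v]
      simp
    have h3 : a 0 = ∫ x, ψ x • U x := by rw [ha_eq]; simp
    have hi0 : Integrable (fun x => ψ x • U x) volume := by simpa using hi 0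
    rw [h2, h3, ← integral_sub (hi v) hi0,
      ← setIntegral_eq_integral_of_forall_compl_eq_zero (s := S)]
    · refine integral_congr_ae (Filter.Eventually.of_forall fun x => ?_)
      change ψ x • U (x + v) - ψ x • U x = ψ x • (u (x + v) - u x)
      by_cases hx : x ∈ tsupport ψ
      · have hxv : x + v ∈ Ω := by simpa using hS x (hs hx) 1 (by simp)
        have hx0 : x ∈ Ω := by simpa using hS x (hs hx) 0 (by simp)
        rw [hU, Set.indicator_of_mem hxv, Set.indicator_of_mem hx0, smul_sub]
      · simp [image_eq_zero_of_notMem_tsupport hx]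
    · intro x hx
      simp [image_eq_zero_of_notMem_tsupport fun h => hx (hs h)]
  rwa [h1] at hmvt

end Translation

/-! ### The Poincaré inequality -/

section Poincare

variable {d : ℕ} {Ω : Set (EuclideanSpace ℝ (Fin d))}

/-- Dual form of the estimate for translated test functions. Those are real-valued, so real and
imaginary parts are bounded separately; hence the factor `2`. -/
theorem IsWeakGradient.eLpNorm_translate_sub_le (hΩ : MeasurableSet Ω) {u : L2Dom Ω}
    {g : L2VecDom Ω} (h : IsWeakGradient u g) {S : Set (EuclideanSpace ℝ (Fin d))}
    (hSo : IsOpen S) {v : EuclideanSpace ℝ (Fin d)}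
    (hS : ∀ x ∈ S, ∀ t ∈ Set.Icc (0 : ℝ) 1, x + t • v ∈ Ω) :
    eLpNorm (fun x => u (x + v) - u x) 2 (volume.restrict S) ≤ 2 * ‖v‖ₑ * ‖g‖ₑ := by
  set f : EuclideanSpace ℝ (Fin d) → ℂ := fun x => u (x + v) - u x with hf
  have hSΩ : S ⊆ Ω := fun x hx => by simpa using hS x hx 0 (by simp)
  have hmem : MemLp f 2 (volume.restrict S) := by
    refine MemLp.sub ?_ ((Lp.memLp u).mono_measure (Measure.restrict_mono hSΩ le_rfl))
    have h1 : MemLp (fun x => Ω.indicator u (x + v)) 2 volume :=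
      ((memLp_indicator_iff_restrict hΩ).2 (Lp.memLp u)).comp_measurePreserving
        (measurePreserving_add_right volume v)
    refine (h1.restrict S).ae_eq ?_
    filter_upwards [ae_restrict_mem hSo.measurableSet] with x hx
    exact Set.indicator_of_mem (by simpa using hS x hx 1 (by simp)) _
  have hM : (0 : ℝ) ≤ ‖v‖ * ‖g‖ := by positivity
  have htest : ∀ ψ : EuclideanSpace ℝ (Fin d) → ℝ, ContDiff ℝ ∞ ψ → HasCompactSupport ψ →
      tsupport ψ ⊆ S → Integrable (fun x => ψ x • f x) (volume.restrict S) ∧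
        ‖∫ x in S, ψ x • f x‖ ≤ ‖v‖ * ‖g‖ * (eLpNorm ψ 2 (volume.restrict S)).toReal := by
    intro ψ h1 h2 h3
    refine ⟨integrable_smul_L2Dom h1.continuous h2 hmem, ?_⟩
    rw [eLpNorm_restrict_eq_of_support_subset ((subset_tsupport ψ).trans h3)]
    exact h.norm_integral_translate_le hΩ hS h1 h2 h3
  have hre : eLpNorm (fun x => (f x).re) 2 (volume.restrict S) ≤ ENNReal.ofReal (‖v‖ * ‖g‖) := by
    refine eLpNorm_le_of_forall_test hSo hmem.re hM fun ψ h1 h2 h3 => ?_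
    obtain ⟨hi, hb⟩ := htest ψ h1 h2 h3
    have h4 : ∫ x in S, ψ x * (f x).re = (∫ x in S, ψ x • f x).re := by
      have h5 := integral_re hi
      simpa using h5
    change |∫ x in S, ψ x * (f x).re| ≤ _
    rw [h4]
    exact (Complex.abs_re_le_norm _).trans hb
  have him : eLpNorm (fun x => (f x).im) 2 (volume.restrict S) ≤ ENNReal.ofReal (‖v‖ * ‖g‖) := by
    refine eLpNorm_le_of_forall_test hSo hmem.im hM fun ψ h1 h2 h3 => ?_
    obtain ⟨hi, hb⟩ := htest ψ h1 h2 h3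
    have h4 : ∫ x in S, ψ x * (f x).im = (∫ x in S, ψ x • f x).im := by
      have h5 := integral_im hi
      simpa using h5
    change |∫ x in S, ψ x * (f x).im| ≤ _
    rw [h4]
    exact (Complex.abs_im_le_norm _).trans hb
  calc eLpNorm f 2 (volume.restrict S)
      ≤ eLpNorm ((fun x => |(f x).re|) + fun x => |(f x).im|) 2 (volume.restrict S) := by
        refine eLpNorm_mono_real fun x => ?_
        exact Complex.norm_le_abs_re_add_abs_im (f x)
    _ ≤ eLpNorm (fun x => |(f x).re|) 2 (volume.restrict S) +
          eLpNorm (fun x => |(f x).im|) 2 (volume.restrict S) :=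
        eLpNorm_add_le hmem.re.1.norm hmem.im.1.norm (by norm_num)
    _ = eLpNorm (fun x => (f x).re) 2 (volume.restrict S) +
          eLpNorm (fun x => (f x).im) 2 (volume.restrict S) := by
        congr 1
        · exact eLpNorm_norm fun x => (f x).re
        · exact eLpNorm_norm fun x => (f x).im
    _ ≤ ENNReal.ofReal (‖v‖ * ‖g‖) + ENNReal.ofReal (‖v‖ * ‖g‖) := add_le_add hre him
    _ = 2 * ‖v‖ₑ * ‖g‖ₑ := by
        rw [ENNReal.ofReal_mul (norm_nonneg v), ofReal_norm, ofReal_norm, mul_assoc, two_mul]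

theorem eLpNorm_restrict_union_le {α : Type*} [MeasurableSpace α] {μ : Measure α} {f : α → ℂ}
    (hf : StronglyMeasurable f) {s t : Set α} (hs : MeasurableSet s) (ht : MeasurableSet t) :
    eLpNorm f 2 (μ.restrict (s ∪ t)) ≤ eLpNorm f 2 (μ.restrict s) + eLpNorm f 2 (μ.restrict t) := by
  rw [← eLpNorm_indicator_eq_eLpNorm_restrict hs, ← eLpNorm_indicator_eq_eLpNorm_restrict ht,
    ← eLpNorm_indicator_eq_eLpNorm_restrict (hs.union ht),
    ← eLpNorm_norm (s.indicator f), ← eLpNorm_norm (t.indicator f)]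
  refine le_trans (eLpNorm_mono_real fun x => ?_)
    (eLpNorm_add_le (hf.indicator hs).norm.aestronglyMeasurable
      (hf.indicator ht).norm.aestronglyMeasurable (by norm_num))
  by_cases h1 : x ∈ s <;> by_cases h2 : x ∈ t <;> simp [h1, h2]

/-- The `L^2` norm on `S` of functions in `H^1(Ω)` is controlled by the gradient and the `L^2` norm
on `B`. -/
def IsControlled (Ω B S : Set (EuclideanSpace ℝ (Fin d))) : Prop :=
  ∃ C : ℝ≥0, ∀ w : H1 Ω, eLpNorm (H1.toFun w) 2 (volume.restrict S) ≤
    C * (‖H1.grad w‖ₑ + eLpNorm (H1.toFun w) 2 (volume.restrict B))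

theorem IsControlled.mono {B S S' : Set (EuclideanSpace ℝ (Fin d))} (h : IsControlled Ω B S)
    (hS : S' ⊆ S) : IsControlled Ω B S' := by
  obtain ⟨C, hC⟩ := h
  exact ⟨C, fun w => (eLpNorm_mono_measure _ (Measure.restrict_mono hS le_rfl)).trans (hC w)⟩

theorem isControlled_self (B : Set (EuclideanSpace ℝ (Fin d))) : IsControlled Ω B B :=
  ⟨1, fun w => by simp⟩

theorem isControlled_empty (B : Set (EuclideanSpace ℝ (Fin d))) : IsControlled Ω B ∅ :=
  ⟨1, fun w => by simp⟩

theorem IsControlled.union {B S S' : Set (EuclideanSpace ℝ (Fin d))} (h : IsControlled Ω B S)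
    (h' : IsControlled Ω B S') (hS : MeasurableSet S) (hS' : MeasurableSet S') :
    IsControlled Ω B (S ∪ S') := by
  obtain ⟨C, hC⟩ := h
  obtain ⟨C', hC'⟩ := h'
  refine ⟨C + C', fun w => ?_⟩
  refine (eLpNorm_restrict_union_le (Lp.stronglyMeasurable _) hS hS').trans ?_
  push_cast
  rw [add_mul]
  exact add_le_add (hC w) (hC' w)

/-- On `S'`, write `u(x) = u(x + v) - (u(x + v) - u(x))`: the first term is controlled through `S`,
the second by the gradient. -/
theorem IsControlled.of_translate (hΩ : MeasurableSet Ω) {B S S' : Set (EuclideanSpace ℝ (Fin d))}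
    (h : IsControlled Ω B S) {v : EuclideanSpace ℝ (Fin d)} (hS'o : IsOpen S')
    (hS' : ∀ x ∈ S', x + v ∈ S) (hseg : ∀ x ∈ S', ∀ t ∈ Set.Icc (0 : ℝ) 1, x + t • v ∈ Ω) :
    IsControlled Ω B S' := by
  obtain ⟨C, hC⟩ := h
  refine ⟨2 * ‖v‖₊ + C, fun w => ?_⟩
  have hu : StronglyMeasurable (H1.toFun w) := Lp.stronglyMeasurable _
  have huv : StronglyMeasurable fun x => H1.toFun w (x + v) :=
    hu.comp_measurable (measurable_add_const v)
  have h1 : eLpNorm (fun x => H1.toFun w (x + v)) 2 (volume.restrict S') ≤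
      eLpNorm (H1.toFun w) 2 (volume.restrict S) := by
    have h2 : MeasurePreserving (fun x => x + v) 
        (volume.restrict ((fun x => x + v) ⁻¹' (S'.image (fun x => x + v))))
        (volume.restrict (S'.image (fun x => x + v))) :=
      (measurePreserving_add_right volume v).restrict_preimage
        ((Homeomorph.addRight v).isOpenMap S' hS'o).measurableSet
    rw [Set.preimage_image_eq _ (add_left_injective v)] at h2
    have h3 := eLpNorm_comp_measurePreserving (p := 2) hu.aestronglyMeasurable h2
    refine (le_of_eq h3).trans (eLpNorm_mono_measure _ (Measure.restrict_mono ?_ le_rfl))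
    rintro _ ⟨x, hx, rfl⟩
    exact hS' x hx
  have h4 : eLpNorm (H1.toFun w) 2 (volume.restrict S') ≤
      eLpNorm (fun x => H1.toFun w (x + v)) 2 (volume.restrict S') +
        eLpNorm (fun x => H1.toFun w (x + v) - H1.toFun w x) 2 (volume.restrict S') := by
    have h5 := eLpNorm_sub_le (p := 2) (μ := volume.restrict S') huv.aestronglyMeasurable
      (huv.sub hu).aestronglyMeasurable (by norm_num)
    rwa [sub_sub_cancel] at h5
  have h6 := IsWeakGradient.eLpNorm_translate_sub_le hΩ (u := H1.toFun w) (g := H1.grad w) w.2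
    hS'o hseg
  calc eLpNorm (H1.toFun w) 2 (volume.restrict S')
      ≤ C * (‖H1.grad w‖ₑ + eLpNorm (H1.toFun w) 2 (volume.restrict B)) +
          2 * ‖v‖ₑ * ‖H1.grad w‖ₑ := h4.trans (add_le_add (h1.trans (hC w)) h6)
    _ ≤ C * (‖H1.grad w‖ₑ + eLpNorm (H1.toFun w) 2 (volume.restrict B)) +
          2 * ‖v‖ₑ * (‖H1.grad w‖ₑ + eLpNorm (H1.toFun w) 2 (volume.restrict B)) := by
        gcongr
        exact le_self_add
    _ = _ := by
        push_cast
        rw [enorm_eq_nnnorm v]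
        ring

/-- In a connected open set, control propagates to a neighbourhood of every point. -/
theorem exists_isControlled_ball (hΩ : IsOpen Ω) (hc : IsPreconnected Ω)
    {x₀ : EuclideanSpace ℝ (Fin d)} {r₀ : ℝ} (hr₀ : 0 < r₀) (hx₀ : x₀ ∈ Ω)
    {x : EuclideanSpace ℝ (Fin d)} (hx : x ∈ Ω) :
    ∃ r > 0, IsControlled Ω (Metric.ball x₀ r₀) (Metric.ball x r) := by
  let G : Set (EuclideanSpace ℝ (Fin d)) :=
    {x | ∃ r > 0, IsControlled Ω (Metric.ball x₀ r₀) (Metric.ball x r)}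
  have hGo : IsOpen G := by
    rw [Metric.isOpen_iff]
    rintro y ⟨r, hr, h⟩
    refine ⟨r / 2, by positivity, fun z hz => ⟨r / 2, by positivity, h.mono ?_⟩⟩
    refine Metric.ball_subset_ball' ?_
    rw [Metric.mem_ball] at hz
    linarith
  have hsub : Ω ⊆ G := by
    refine hc.subset_of_closure_inter_subset hGo ⟨x₀, hx₀, r₀, hr₀, isControlled_self _⟩ ?_
    -- The set `G` is also relatively closed: a small ball at a limit point `y` is translated onto
    -- part of a controlled ball at a nearby `z`. The two halves of `r` bound the offset from `y`
    -- and the translation, so the segments stay in `Ω`.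
    rintro y ⟨hy, hyΩ⟩
    obtain ⟨r, hr, hball⟩ := Metric.isOpen_iff.1 hΩ y hyΩ
    obtain ⟨z, ⟨s, hs, hz⟩, hzy⟩ := Metric.mem_closure_iff.1 hy (r / 2) (by positivity)
    refine ⟨min s (r / 2), by positivity, ?_⟩
    refine hz.of_translate hΩ.measurableSet (v := z - y) Metric.isOpen_ball ?_ ?_
    · intro a ha
      rw [Metric.mem_ball, dist_eq_norm] at ha ⊢
      have : a + (z - y) - z = a - y := by abel
      rw [this]
      exact ha.trans_le (min_le_left _ _)
    · intro a ha t ht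
      refine hball ?_
      rw [Metric.mem_ball, dist_eq_norm] at ha ⊢
      have h1 : ‖a + t • (z - y) - y‖ ≤ ‖a - y‖ + ‖t • (z - y)‖ := by
        have : a + t • (z - y) - y = (a - y) + t • (z - y) := by abel
        rw [this]
        exact norm_add_le _ _
      have h2 : ‖t • (z - y)‖ ≤ ‖z - y‖ := by
        rw [norm_smul, Real.norm_of_nonneg ht.1]
        exact mul_le_of_le_one_left (norm_nonneg _) ht.2
      have h3 : ‖z - y‖ < r / 2 := by rwa [← dist_eq_norm, dist_comm]
      have h4 := ha.trans_le (min_le_right _ _)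
      linarith
  exact hsub hx

theorem orthogonalProjectionOnto_add_smul_self (e x : EuclideanSpace ℝ (Fin d)) (t : ℝ) :
    (Submodule.span ℝ {e})ᗮ.orthogonalProjectionOnto (x + t • e) =
      (Submodule.span ℝ {e})ᗮ.orthogonalProjectionOnto x := by
  have h : (Submodule.span ℝ {e})ᗮ.orthogonalProjectionOnto e = 0 := by
    rw [Submodule.orthogonalProjectionOnto_eq_zero_iff, Submodule.orthogonal_orthogonal]
    exact Submodule.mem_span_singleton_self e
  rw [map_add, map_smul, h, smul_zero, add_zero]

theorem inner_add_smul_self {e : EuclideanSpace ℝ (Fin d)} (he : ‖e‖ = 1)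
    (x : EuclideanSpace ℝ (Fin d)) (t : ℝ) : inner ℝ e (x + t • e) = inner ℝ e x + t := by
  rw [inner_add_right, inner_smul_right, real_inner_self_eq_norm_sq, he]
  ring

/-- Near a boundary point at which `Ω` is the region above a graph, the boundary is the graph. -/
theorem mem_frontier_iff_of_graph (hΩ : IsOpen Ω) {p e : EuclideanSpace ℝ (Fin d)}
    {γ : ↥(Submodule.span ℝ {e})ᗮ → ℝ} {r : ℝ} (he : ‖e‖ = 1) (hγ : Continuous γ)
    (h : ∀ x ∈ Metric.ball p r,
      (x ∈ Ω ↔ γ ((Submodule.span ℝ {e})ᗮ.orthogonalProjectionOnto x) < inner ℝ e x))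
    {x : EuclideanSpace ℝ (Fin d)} (hx : x ∈ Metric.ball p r) :
    x ∈ frontier Ω ↔ γ ((Submodule.span ℝ {e})ᗮ.orthogonalProjectionOnto x) = inner ℝ e x := by
  rw [hΩ.frontier_eq, Set.mem_sdiff]
  constructor
  · rintro ⟨hcl, hx'⟩
    rw [h x hx, not_lt] at hx'
    refine le_antisymm ?_ hx'
    have hmem : x ∈ closure (Ω ∩ Metric.ball p r) :=
      (Metric.isOpen_ball.closure_inter ⟨hcl, hx⟩)
    have hclosed : IsClosed {y : EuclideanSpace ℝ (Fin d) |
        γ ((Submodule.span ℝ {e})ᗮ.orthogonalProjectionOnto y) ≤ inner ℝ e y} :=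
      isClosed_le (hγ.comp (ContinuousLinearMap.continuous _)) (by fun_prop)
    exact closure_minimal (fun y hy => ((h y hy.2).1 hy.1).le) hclosed hmem
  · intro heq
    refine ⟨?_, fun hx' => ((h x hx).1 hx').ne heq⟩
    rw [Metric.mem_closure_iff]
    intro ε hε
    have hpos : 0 < r - dist x p := sub_pos.2 hx
    -- Moving up by any `t > 0` from the graph enters `Ω`, as long as the point stays in the chart;
    -- the minimum also keeps it within `ε`.
    set t := min (ε / 2) ((r - dist x p) / 2) with ht
    have ht0 : 0 < t := by positivity
    have hd : dist (x + t • e) x = t := by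
      rw [dist_eq_norm, add_sub_cancel_left, norm_smul, he, mul_one, Real.norm_of_nonneg ht0.le]
    refine ⟨x + t • e, (h _ ?_).2 ?_, ?_⟩
    · rw [Metric.mem_ball]
      have := dist_triangle (x + t • e) x p
      have := min_le_right (ε / 2) ((r - dist x p) / 2)
      linarith
    · rw [orthogonalProjectionOnto_add_smul_self, inner_add_smul_self he, heq]
      linarith
    · rw [dist_comm, hd]
      have := min_le_left (ε / 2) ((r - dist x p) / 2)
      linarith

/-- In a chart, upward segments starting in `Ω` remain in `Ω`. Translation by `(r / 2) • e`
therefore carries a boundary patch into a ball around the interior point `p + (r / 2) • e`, where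
control is known. -/
theorem exists_isControlled_ball_inter (hΩ : IsBoundedLipschitzDomain Ω)
    {x₀ : EuclideanSpace ℝ (Fin d)} {r₀ : ℝ} (hr₀ : 0 < r₀) (hx₀ : x₀ ∈ Ω)
    {p : EuclideanSpace ℝ (Fin d)} (hp : p ∈ frontier Ω) :
    ∃ s > 0, IsControlled Ω (Metric.ball x₀ r₀) (Metric.ball p s ∩ Ω) := by
  obtain ⟨e, γ, K, r, he, hγ, hr, h⟩ := hΩ.exists_graph p hp
  have hpγ := (mem_frontier_iff_of_graph hΩ.isOpen he hγ.continuous h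
    (Metric.mem_ball_self hr)).1 hp
  have hmove : ∀ x t, 0 ≤ t → γ ((Submodule.span ℝ {e})ᗮ.orthogonalProjectionOnto x) < inner ℝ e x + t →
      dist x p + t < r → x + t • e ∈ Ω := by
    intro x t ht hx hd
    refine (h _ ?_).2 ?_
    · rw [Metric.mem_ball]
      have h1 := dist_triangle (x + t • e) x p
      have h2 : dist (x + t • e) x = t := by
        rw [dist_eq_norm, add_sub_cancel_left, norm_smul, he, mul_one, Real.norm_of_nonneg ht]
      linarith
    · rwa [orthogonalProjectionOnto_add_smul_self, inner_add_smul_self he]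
  have hq : p + (r / 2) • e ∈ Ω := by
    refine hmove p (r / 2) (by positivity) ?_ ?_
    · rw [hpγ]; linarith
    · rw [dist_self]; linarith
  obtain ⟨s, hs, hcs⟩ := exists_isControlled_ball hΩ.isOpen hΩ.isConnected.isPreconnected
    hr₀ hx₀ hq
  -- Radius `r / 4` plus displacement `r / 2` stays below the chart radius `r`.
  refine ⟨min s (r / 4), by positivity, ?_⟩
  refine hcs.of_translate hΩ.isOpen.measurableSet (v := (r / 2) • e)
    (Metric.isOpen_ball.inter hΩ.isOpen) ?_ ?_
  · rintro x ⟨hx, -⟩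
    rw [Metric.mem_ball, dist_add_right]
    exact (Metric.mem_ball.1 hx).trans_le (min_le_left _ _)
  · rintro x ⟨hx, hxΩ⟩ t ht
    have hx' := (Metric.mem_ball.1 hx).trans_le (min_le_right _ _)
    have ht0 : 0 ≤ t * (r / 2) := mul_nonneg ht.1 (by positivity)
    have ht1 : t * (r / 2) ≤ r / 2 := mul_le_of_le_one_left (by positivity) ht.2
    rw [smul_smul]
    refine hmove x _ ht0 ?_ (by linarith)
    have := (h x (Metric.mem_ball.2 (by linarith))).1 hxΩ
    linarith

/-- Interior balls and boundary patches cover the compact closure, and control passes to finite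
unions. -/
theorem isControlled_domain (hΩ : IsBoundedLipschitzDomain Ω)
    {x₀ : EuclideanSpace ℝ (Fin d)} {r₀ : ℝ} (hr₀ : 0 < r₀) (hx₀ : x₀ ∈ Ω) :
    IsControlled Ω (Metric.ball x₀ r₀) Ω := by
  have hcpt : IsCompact (closure Ω) := hΩ.isBounded.isCompact_closure
  have key : ∃ s, closure Ω ⊆ s ∧ MeasurableSet s ∧
      IsControlled Ω (Metric.ball x₀ r₀) (s ∩ Ω) := by
    refine hcpt.induction_on (p := fun t => ∃ s, t ⊆ s ∧ MeasurableSet s ∧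
      IsControlled Ω (Metric.ball x₀ r₀) (s ∩ Ω)) ?_ ?_ ?_ ?_
    · exact ⟨∅, subset_rfl, MeasurableSet.empty, (isControlled_empty _).mono (by simp)⟩
    · rintro s t hst ⟨s', h1, h2⟩
      exact ⟨s', hst.trans h1, h2⟩
    · rintro s t ⟨s', h1, h2, h3⟩ ⟨t', k1, k2, k3⟩
      refine ⟨s' ∪ t', Set.union_subset_union h1 k1, h2.union k2, ?_⟩
      rw [Set.union_inter_distrib_right]
      exact h3.union k3 (h2.inter hΩ.isOpen.measurableSet) (k2.inter hΩ.isOpen.measurableSet)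
    · intro x hx
      by_cases hxΩ : x ∈ Ω
      · obtain ⟨r, hr, h⟩ := exists_isControlled_ball hΩ.isOpen hΩ.isConnected.isPreconnected
          hr₀ hx₀ hxΩ
        exact ⟨_, mem_nhdsWithin_of_mem_nhds (Metric.ball_mem_nhds x hr), _, subset_rfl,
          Metric.isOpen_ball.measurableSet, h.mono Set.inter_subset_left⟩
      · have hxf : x ∈ frontier Ω := by
          rw [hΩ.isOpen.frontier_eq]; exact ⟨hx, hxΩ⟩
        obtain ⟨r, hr, h⟩ := exists_isControlled_ball_inter hΩ hr₀ hx₀ hxf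
        exact ⟨_, mem_nhdsWithin_of_mem_nhds (Metric.ball_mem_nhds x hr), _, subset_rfl,
          Metric.isOpen_ball.measurableSet, h⟩
  obtain ⟨s, hs, -, h⟩ := key
  exact h.mono fun x hx => ⟨hs (subset_closure hx), hx⟩

theorem eLpNorm_two_sq {α F : Type*} [MeasurableSpace α] [NormedAddCommGroup F] {μ : Measure α}
    (f : α → F) :
    eLpNorm f 2 μ ^ 2 = ∫⁻ x, ‖f x‖ₑ ^ 2 ∂μ := by
  have h := eLpNorm_nnreal_pow_eq_lintegral (f := f) (μ := μ) (p := 2) two_ne_zero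
  simpa using h

/-- On a ball, functions in `H^1` are close to constants. -/
theorem exists_const_eLpNorm_ball_le (hΩ : MeasurableSet Ω) {x₀ : EuclideanSpace ℝ (Fin d)} {r : ℝ}
    (hr : 0 < r) (hball : Metric.ball x₀ r ⊆ Ω) :
    ∃ C : ℝ≥0, ∀ w : H1 Ω, ∃ c : ℂ,
      eLpNorm (fun x => H1.toFun w x - c) 2 (volume.restrict (Metric.ball x₀ r)) ≤
        C * ‖H1.grad w‖ₑ := by
  set B := Metric.ball x₀ r with hB
  have hBm : MeasurableSet B := Metric.isOpen_ball.measurableSet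
  have hB0 : volume B ≠ 0 := (Metric.measure_ball_pos volume x₀ hr).ne'
  have hBt : volume B ≠ ⊤ := measure_ball_lt_top.ne
  -- All differences of two points of `B` lie in `V`.
  set V := Metric.ball (0 : EuclideanSpace ℝ (Fin d)) (2 * r) with hV
  have hVt : volume V ≠ ⊤ := measure_ball_lt_top.ne
  set K : ℝ≥0∞ := (volume B)⁻¹ * (volume V * ENNReal.ofReal (4 * r) ^ 2) with hK
  have hKt : K ≠ ⊤ := by
    rw [hK]
    exact ENNReal.mul_ne_top (ENNReal.inv_ne_top.2 hB0)
      (ENNReal.mul_ne_top hVt (ENNReal.pow_ne_top ENNReal.ofReal_ne_top))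
  refine ⟨NNReal.sqrt K.toNNReal, fun w => ?_⟩
  set u := H1.toFun w with hu
  have hum : Measurable u := (Lp.stronglyMeasurable _).measurable
  have hFm : Measurable fun z : EuclideanSpace ℝ (Fin d) × EuclideanSpace ℝ (Fin d) =>
      B.indicator (fun _ => (1 : ℝ≥0∞)) z.1 * B.indicator (fun _ => (1 : ℝ≥0∞)) (z.1 + z.2) *
        ‖u (z.1 + z.2) - u z.1‖ₑ ^ 2 := by
    have h1 : Measurable (B.indicator (fun _ => (1 : ℝ≥0∞))) :=
      measurable_const.indicator hBm
    have hadd : Measurable fun z : EuclideanSpace ℝ (Fin d) × EuclideanSpace ℝ (Fin d) =>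
      z.1 + z.2 := measurable_fst.add measurable_snd
    exact ((h1.comp measurable_fst).mul (h1.comp hadd)).mul
      (((hum.comp hadd).sub (hum.comp measurable_fst)).enorm.pow_const 2)
  have hGm : Measurable fun x => ∫⁻ y in B, ‖u y - u x‖ₑ ^ 2 := by
    refine Measurable.lintegral_prod_right' (f := fun z :
      EuclideanSpace ℝ (Fin d) × EuclideanSpace ℝ (Fin d) => ‖u z.2 - u z.1‖ₑ ^ 2) ?_
    exact ((hum.comp measurable_snd).sub (hum.comp measurable_fst)).enorm.pow_const 2
  -- With `y = x + v` and Tonelli, the inner integral is the squared translation difference over `B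
  -- ∩ (B - v)`. Convexity of `B` supplies the segments, and `2 ‖v‖ ≤ 4 r` on `V`.
  have hdouble : ∫⁻ x in B, ∫⁻ y in B, ‖u y - u x‖ₑ ^ 2 ≤
      volume V * ENNReal.ofReal (4 * r) ^ 2 * ‖H1.grad w‖ₑ ^ 2 := by
    calc ∫⁻ x in B, ∫⁻ y in B, ‖u y - u x‖ₑ ^ 2
        = ∫⁻ x, ∫⁻ v, B.indicator (fun _ => (1 : ℝ≥0∞)) x * B.indicator (fun _ => (1 : ℝ≥0∞)) (x + v) *
            ‖u (x + v) - u x‖ₑ ^ 2 := by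
          rw [← lintegral_indicator hBm]
          refine lintegral_congr fun x => ?_
          by_cases hx : x ∈ B
          · rw [Set.indicator_of_mem hx, Set.indicator_of_mem hx, ← lintegral_indicator hBm,
              ← lintegral_add_left_eq_self _ x]
            refine lintegral_congr fun v => ?_
            by_cases hv : x + v ∈ B <;> simp [hv]
          · simp [hx]
      _ = ∫⁻ v, ∫⁻ x, B.indicator (fun _ => (1 : ℝ≥0∞)) x * B.indicator (fun _ => (1 : ℝ≥0∞)) (x + v) *
            ‖u (x + v) - u x‖ₑ ^ 2 := lintegral_lintegral_swap hFm.aemeasurable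
      _ ≤ ∫⁻ v, V.indicator (fun _ => (ENNReal.ofReal (4 * r) * ‖H1.grad w‖ₑ) ^ 2) v := by
          refine lintegral_mono fun v => ?_
          by_cases hv : v ∈ V
          · rw [Set.indicator_of_mem hv]
            set S := B ∩ (fun x => x + v) ⁻¹' B with hS
            have hSo : IsOpen S :=
              Metric.isOpen_ball.inter (Metric.isOpen_ball.preimage (continuous_add_const v))
            have h1 : ∫⁻ x, B.indicator (fun _ => (1 : ℝ≥0∞)) x * B.indicator (fun _ => (1 : ℝ≥0∞)) (x + v) *
                ‖u (x + v) - u x‖ₑ ^ 2 = ∫⁻ x in S, ‖u (x + v) - u x‖ₑ ^ 2 := by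
              rw [← lintegral_indicator hSo.measurableSet]
              refine lintegral_congr fun x => ?_
              by_cases hx : x ∈ B <;> by_cases hxv : x + v ∈ B <;> simp [hS, hx, hxv]
            have h2 := IsWeakGradient.eLpNorm_translate_sub_le hΩ (u := H1.toFun w)
              (g := H1.grad w) w.2 hSo (v := v) (by
                rintro x ⟨hx, hxv⟩ t ht
                refine hball ?_
                have h3 := (convex_ball x₀ r) hx hxv (sub_nonneg.2 ht.2) ht.1 (by ring)
                convert h3 using 1
                module)
            rw [h1, ← eLpNorm_two_sq]
            refine pow_le_pow_left' (h2.trans ?_) 2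
            gcongr
            have h4 : (2 : ℝ≥0∞) * ‖v‖ₑ = ENNReal.ofReal (2 * ‖v‖) := by
              rw [ENNReal.ofReal_mul (by norm_num), ofReal_norm, ENNReal.ofReal_ofNat]
            rw [h4]
            refine ENNReal.ofReal_le_ofReal ?_
            have := mem_ball_zero_iff.1 hv
            linarith
          · rw [Set.indicator_of_notMem hv, nonpos_iff_eq_zero]
            have h0 : ∀ x, B.indicator (fun _ => (1 : ℝ≥0∞)) x * B.indicator (fun _ => (1 : ℝ≥0∞)) (x + v) *
                ‖u (x + v) - u x‖ₑ ^ 2 = 0 := by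
              intro x
              by_cases hx : x ∈ B
              · have hxv : x + v ∉ B := by
                  intro hxv
                  refine hv (mem_ball_zero_iff.2 ?_)
                  have h1 := Metric.mem_ball.1 hx
                  have h2 := Metric.mem_ball.1 hxv
                  have h3 := dist_triangle_right (x + v) x x₀
                  rw [dist_eq_norm, add_sub_cancel_left] at h3
                  linarith
                simp [hxv]
              · simp [hx]
            simp [h0]
      _ = volume V * ENNReal.ofReal (4 * r) ^ 2 * ‖H1.grad w‖ₑ ^ 2 := by
          rw [lintegral_indicator_const Metric.isOpen_ball.measurableSet, mul_pow]
          ring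
  -- Some `x` does no worse than the average over `B`, and the value `u x` serves as the constant.
  obtain ⟨x, hx, hle⟩ := exists_le_setLAverage hB0 hBt hGm.aemeasurable
  refine ⟨u x, ?_⟩
  have h1 : eLpNorm (fun y => u y - u x) 2 (volume.restrict B) ^ 2 ≤
      ((NNReal.sqrt K.toNNReal : ℝ≥0) * ‖H1.grad w‖ₑ) ^ 2 := by
    rw [eLpNorm_two_sq]
    refine hle.trans ?_
    rw [setLAverage_eq, ENNReal.div_eq_inv_mul]
    calc (volume B)⁻¹ * ∫⁻ x in B, ∫⁻ y in B, ‖u y - u x‖ₑ ^ 2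
        ≤ (volume B)⁻¹ * (volume V * ENNReal.ofReal (4 * r) ^ 2 * ‖H1.grad w‖ₑ ^ 2) := by gcongr
      _ = K * ‖H1.grad w‖ₑ ^ 2 := by rw [hK]; ring
      _ = _ := by
          rw [mul_pow, ← ENNReal.coe_pow, NNReal.sq_sqrt, ENNReal.coe_toNNReal hKt]
  exact (ENNReal.pow_le_pow_left_iff two_ne_zero).1 h1

end Poincare

/-! ### Poincaré inequalities on the whole domain -/

section PoincareMean

variable {d : ℕ} {Ω Γ : Set (EuclideanSpace ℝ (Fin d))}

theorem IsBoundedLipschitzDomain.volume_ne_top (hΩ : IsBoundedLipschitzDomain Ω) :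
    volume Ω ≠ ⊤ := hΩ.isBounded.measure_lt_top.ne

/-- The Poincaré–Wirtinger inequality: functions in `H^1(Ω)` are close to constants. -/
theorem exists_norm_sub_const_le (hΩ : IsBoundedLipschitzDomain Ω) (hv : volume Ω ≠ ⊤) :
    ∃ C : ℝ, 0 ≤ C ∧ ∀ w : H1 Ω, ∃ c : ℂ, ‖w - H1.const hv c‖ ≤ C * ‖H1.grad w‖ := by
  obtain ⟨x₀, hx₀⟩ := hΩ.isConnected.nonempty
  obtain ⟨r, hr, hball⟩ := Metric.isOpen_iff.1 hΩ.isOpen x₀ hx₀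
  obtain ⟨C₁, hC₁⟩ := isControlled_domain hΩ hr hx₀
  obtain ⟨C₂, hC₂⟩ := exists_const_eLpNorm_ball_le hΩ.isOpen.measurableSet hr hball
  -- After subtracting the constant found on the ball, `C₂` bounds the `L²` norm there and `C₁`
  -- carries it to `Ω`; the final `1` accounts for the gradient part of the norm.
  refine ⟨C₁ * (1 + C₂) + 1, by positivity, fun w => ?_⟩
  obtain ⟨c, hc⟩ := hC₂ w
  refine ⟨c, ?_⟩
  set z := w - H1.const hv c with hz
  have hgrad : H1.grad z = H1.grad w := by
    rw [hz, ← gradL_apply, map_sub, gradL_apply, gradL_apply, H1.grad_const, sub_zero]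
  have hfun : H1.toFun z =ᵐ[volume.restrict Ω] fun x => H1.toFun w x - c := by
    rw [hz, ← toFunL_apply, map_sub, toFunL_apply, toFunL_apply]
    filter_upwards [Lp.coeFn_sub (H1.toFun w) (H1.toFun (H1.const hv c)),
      H1.toFun_const_ae hv c] with x h1 h2
    rw [h1, Pi.sub_apply, h2]
  have h1 : ‖H1.toFun z‖ₑ ≤ C₁ * (‖H1.grad w‖ₑ + C₂ * ‖H1.grad w‖ₑ) := by
    rw [Lp.enorm_def]
    refine (hC₁ z).trans ?_
    rw [hgrad]
    gcongr
    rw [eLpNorm_congr_ae (ae_restrict_of_ae_restrict_of_subset hball hfun)]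
    exact hc
  have h2 : ‖H1.toFun z‖ ≤ C₁ * (‖H1.grad w‖ + C₂ * ‖H1.grad w‖) := by
    have h3 := ENNReal.toReal_mono (by finiteness) h1
    rwa [ENNReal.toReal_mul, ENNReal.toReal_add (by finiteness) (by finiteness),
      ENNReal.toReal_mul, toReal_enorm, toReal_enorm, ENNReal.coe_toReal, ENNReal.coe_toReal] at h3
  have h4 : ‖z‖ ≤ ‖H1.toFun z‖ + ‖H1.grad z‖ := by
    refine (pow_le_pow_iff_left₀ (norm_nonneg z) (by positivity) two_ne_zero).1 ?_
    rw [H1.norm_sq_eq]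
    nlinarith [norm_nonneg (H1.toFun z), norm_nonneg (H1.grad z)]
  rw [hgrad] at h4
  linarith

theorem H1.const_eq_smul (hv : volume Ω ≠ ⊤) (c : ℂ) : H1.const hv c = c • H1.const hv 1 := by
  have : IsFiniteMeasure (volume.restrict Ω) := ⟨by simpa using hv.lt_top⟩
  refine Subtype.ext ?_
  change WithLp.toLp 2 (_, _) = c • WithLp.toLp 2 (_, _)
  rw [← WithLp.toLp_smul, Prod.smul_mk, smul_zero]
  congr 2
  refine Lp.ext ?_
  filter_upwards [Lp.coeFn_const 2 (volume.restrict Ω) c,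
    Lp.coeFn_const 2 (volume.restrict Ω) (1 : ℂ),
    Lp.coeFn_smul c (Lp.const 2 (volume.restrict Ω) (1 : ℂ))] with x h1 h2 h3
  rw [h1, h3, Pi.smul_apply, h2]
  simp

/-- The Poincaré inequality on `H^1_⋄(Ω)`. -/
theorem exists_poincare_H1Mean (hΩ : IsBoundedLipschitzDomain Ω)
    [IsFiniteMeasure (surfaceMeasure Γ)] (hpos : surfaceMeasure Γ ≠ 0)
    (hT : IsTraceOp Ω Γ (traceOp Ω Γ)) :
    ∃ C : ℝ, ∀ w : H1Mean Ω Γ, ‖w‖ ^ 2 ≤ C * ‖H1.grad (w : H1 Ω)‖ ^ 2 := by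
  have hv := hΩ.volume_ne_top
  obtain ⟨K, hK0, hK⟩ := exists_norm_sub_const_le hΩ hv
  let ℓ : H1 Ω →L[ℂ] ℂ :=
    (innerSL ℂ (Lp.const 2 (surfaceMeasure Γ) (1 : ℂ))).comp (traceOp Ω Γ)
  have hℓ : ∀ w, ℓ w = ∫ x, traceOp Ω Γ w x ∂(surfaceMeasure Γ) := by
    intro w
    change inner ℂ (Lp.const 2 (surfaceMeasure Γ) (1 : ℂ)) (traceOp Ω Γ w) = _
    rw [L2.inner_def]
    refine integral_congr_ae ?_
    filter_upwards [Lp.coeFn_const 2 (surfaceMeasure Γ) (1 : ℂ)] with x hx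
    rw [hx]
    simp
  set m := (surfaceMeasure Γ).real Set.univ with hm
  have hm0 : 0 < m := by
    rw [hm, Measure.real, ENNReal.toReal_pos_iff]
    exact ⟨pos_iff_ne_zero.2 (by simpa using hpos), measure_lt_top _ _⟩
  -- Since `ℓ w = 0`, applying `ℓ` to `w - c` gives `-m c`, whence `|c| ≤ (‖ℓ‖ K / m) ‖∇w‖`; the
  -- triangle inequality does the rest.
  refine ⟨(K + ‖ℓ‖ * K / m * ‖H1.const hv 1‖) ^ 2, fun w => ?_⟩
  obtain ⟨c, hc⟩ := hK w
  have h1 : ℓ ((w : H1 Ω) - H1.const hv c) = -(m * c) := by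
    have hw : ℓ (w : H1 Ω) = 0 := (hℓ _).trans w.2.2
    have hcc : ℓ (H1.const hv c) = m * c := by
      rw [hℓ, integral_congr_ae (traceOp_const_ae hT hv c), integral_const, Complex.real_smul]
    rw [map_sub, hw, hcc, zero_sub]
  have h2 : m * ‖c‖ ≤ ‖ℓ‖ * (K * ‖H1.grad (w : H1 Ω)‖) := by
    have h3 := ℓ.le_opNorm ((w : H1 Ω) - H1.const hv c)
    rw [h1, norm_neg, norm_mul, Complex.norm_real, Real.norm_of_nonneg hm0.le] at h3
    exact h3.trans (mul_le_mul_of_nonneg_left hc (norm_nonneg _))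
  have h4 : ‖c‖ ≤ ‖ℓ‖ * K / m * ‖H1.grad (w : H1 Ω)‖ := by
    rw [div_mul_eq_mul_div, le_div_iff₀ hm0]
    linarith
  have h5 : ‖(w : H1 Ω)‖ ≤ ‖(w : H1 Ω) - H1.const hv c‖ + ‖c‖ * ‖H1.const hv 1‖ := by
    rw [← norm_smul, ← H1.const_eq_smul]
    simpa using norm_add_le ((w : H1 Ω) - H1.const hv c) (H1.const hv c)
  have h6 : ‖(w : H1 Ω)‖ ≤ (K + ‖ℓ‖ * K / m * ‖H1.const hv 1‖) * ‖H1.grad (w : H1 Ω)‖ := by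
    have h7 := mul_le_mul_of_nonneg_right h4 (norm_nonneg (H1.const hv 1))
    linarith
  rw [← mul_pow]
  exact pow_le_pow_left₀ (norm_nonneg _) h6 2

end PoincareMean

/-! ### Surface measure of Lipschitz graphs -/

section Surface

variable {d : ℕ}

theorem finrank_orthogonal_span_unit {e : EuclideanSpace ℝ (Fin d)} (he : ‖e‖ = 1) :
    Module.finrank ℝ ↥(Submodule.span ℝ {e})ᗮ = d - 1 := by
  have he0 : e ≠ 0 := by
    rintro rfl
    simp at he
  have h := Submodule.finrank_add_finrank_orthogonal (Submodule.span ℝ {e})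
  rw [finrank_span_singleton he0, finrank_euclideanSpace_fin] at h
  omega

theorem LipschitzWith.euclideanHausdorffMeasure_image_le {X Y : Type*} [EMetricSpace X]
    [MeasurableSpace X] [BorelSpace X] [EMetricSpace Y] [MeasurableSpace Y] [BorelSpace Y]
    {K : ℝ≥0} {f : X → Y} (hf : LipschitzWith K f) (n : ℕ) (s : Set X) :
    Measure.euclideanHausdorffMeasure n (f '' s) ≤
      (K : ℝ≥0∞) ^ n * Measure.euclideanHausdorffMeasure n s := by
  rw [Measure.euclideanHausdorffMeasure_def, Measure.euclideanHausdorffMeasure_def,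
    Measure.smul_apply, Measure.smul_apply, ENNReal.smul_def, ENNReal.smul_def, smul_eq_mul,
    smul_eq_mul, mul_left_comm]
  gcongr
  simpa using hf.hausdorffMeasure_image_le (d := n) (by positivity) s

theorem euclideanHausdorffMeasure_hyperplane {e : EuclideanSpace ℝ (Fin d)} (he : ‖e‖ = 1) :
    (Measure.euclideanHausdorffMeasure (d - 1) : Measure ↥(Submodule.span ℝ {e})ᗮ) = volume := by
  rw [← finrank_orthogonal_span_unit he]
  exact InnerProductSpace.euclideanHausdorffMeasure_eq_volume

/-- The parametrisation of the graph of `γ` over the hyperplane orthogonal to `e`. -/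
noncomputable def graphMap (e : EuclideanSpace ℝ (Fin d)) (γ : ↥(Submodule.span ℝ {e})ᗮ → ℝ)
    (y : ↥(Submodule.span ℝ {e})ᗮ) : EuclideanSpace ℝ (Fin d) := y + γ y • e

theorem lipschitzWith_graphMap {e : EuclideanSpace ℝ (Fin d)} (he : ‖e‖ = 1)
    {γ : ↥(Submodule.span ℝ {e})ᗮ → ℝ} {K : ℝ≥0} (hγ : LipschitzWith K γ) :
    LipschitzWith (1 + K) (graphMap e γ) := by
  refine LipschitzWith.add (LipschitzWith.subtype_val _) (LipschitzWith.of_dist_le_mul fun x y => ?_)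
  rw [dist_eq_norm, ← sub_smul, norm_smul, he, mul_one, ← dist_eq_norm]
  exact hγ.dist_le_mul x y

theorem orthogonalProjectionOnto_graphMap (e : EuclideanSpace ℝ (Fin d))
    (γ : ↥(Submodule.span ℝ {e})ᗮ → ℝ) (y : ↥(Submodule.span ℝ {e})ᗮ) :
    (Submodule.span ℝ {e})ᗮ.orthogonalProjectionOnto (graphMap e γ y) = y := by
  rw [graphMap, orthogonalProjectionOnto_add_smul_self,
    Submodule.orthogonalProjectionOnto_mem_subspace_eq_self]

theorem inner_graphMap {e : EuclideanSpace ℝ (Fin d)} (he : ‖e‖ = 1)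
    (γ : ↥(Submodule.span ℝ {e})ᗮ → ℝ) (y : ↥(Submodule.span ℝ {e})ᗮ) :
    inner ℝ e (graphMap e γ y) = γ y := by
  rw [graphMap, inner_add_smul_self he,
    Submodule.mem_orthogonal_singleton_iff_inner_right.1 y.2, zero_add]

theorem graphMap_orthogonalProjectionOnto {e : EuclideanSpace ℝ (Fin d)} (he : ‖e‖ = 1)
    {γ : ↥(Submodule.span ℝ {e})ᗮ → ℝ} {x : EuclideanSpace ℝ (Fin d)}
    (hx : γ ((Submodule.span ℝ {e})ᗮ.orthogonalProjectionOnto x) = inner ℝ e x) :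
    graphMap e γ ((Submodule.span ℝ {e})ᗮ.orthogonalProjectionOnto x) = x := by
  rw [graphMap, hx]
  have h := Submodule.starProjection_add_starProjection_orthogonal (K := Submodule.span ℝ {e}) x
  rw [Submodule.starProjection_unit_singleton ℝ he, Submodule.starProjection_apply, add_comm] at h
  exact h

/-- A subset of the graph is the image of its preimage under the `(1 + K)`-Lipschitz
parametrisation. -/
theorem measure_le_volume_preimage_graphMap {e : EuclideanSpace ℝ (Fin d)} (he : ‖e‖ = 1)
    {γ : ↥(Submodule.span ℝ {e})ᗮ → ℝ} {K : ℝ≥0} (hγ : LipschitzWith K γ)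
    {S : Set (EuclideanSpace ℝ (Fin d))}
    (hS : ∀ x ∈ S, γ ((Submodule.span ℝ {e})ᗮ.orthogonalProjectionOnto x) = inner ℝ e x) :
    Measure.euclideanHausdorffMeasure (d - 1) S ≤
      ((1 + K : ℝ≥0) : ℝ≥0∞) ^ (d - 1) * volume (graphMap e γ ⁻¹' S) := by
  have h := (lipschitzWith_graphMap he hγ).euclideanHausdorffMeasure_image_le (d - 1)
    (graphMap e γ ⁻¹' S)
  rw [euclideanHausdorffMeasure_hyperplane he] at h
  refine (measure_mono fun x hx => ?_).trans h
  have hx' := graphMap_orthogonalProjectionOnto he (hS x hx)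
  exact ⟨_, by rwa [Set.mem_preimage, hx'], hx'⟩

/-- The projection is a 1-Lipschitz left inverse of `graphMap`, so the preimage is contained in a
ball of the hyperplane. -/
theorem volume_preimage_graphMap_ball_lt_top (e : EuclideanSpace ℝ (Fin d))
    (γ : ↥(Submodule.span ℝ {e})ᗮ → ℝ) (p : EuclideanSpace ℝ (Fin d)) (r : ℝ) :
    volume (graphMap e γ ⁻¹' Metric.ball p r) < ⊤ := by
  have hsub : graphMap e γ ⁻¹' Metric.ball p r ⊆
      Metric.ball ((Submodule.span ℝ {e})ᗮ.orthogonalProjectionOnto p) r := by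
    intro y hy
    have h := (Submodule.span ℝ {e})ᗮ.lipschitzWith_orthogonalProjectionOnto.dist_le_mul
      (graphMap e γ y) p
    rw [orthogonalProjectionOnto_graphMap, NNReal.coe_one, one_mul] at h
    exact h.trans_lt hy
  exact (measure_mono hsub).trans_lt measure_ball_lt_top

variable {Ω Γ : Set (EuclideanSpace ℝ (Fin d))}

theorem IsBoundedLipschitzDomain.isCompact_frontier (hΩ : IsBoundedLipschitzDomain Ω) :
    IsCompact (frontier Ω) :=
  hΩ.isBounded.isCompact_closure.of_isClosed_subset isClosed_frontier frontier_subset_closure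

theorem isFiniteMeasure_surfaceMeasure (hΩ : IsBoundedLipschitzDomain Ω)
    (hΓ : IsRelOpenBoundary Ω Γ) : IsFiniteMeasure (surfaceMeasure Γ) := by
  refine ⟨?_⟩
  rw [surfaceMeasure, Measure.restrict_apply_univ]
  obtain ⟨U, -, rfl⟩ := hΓ
  refine (measure_mono Set.inter_subset_right).trans_lt ?_
  refine hΩ.isCompact_frontier.measure_lt_top_of_nhdsWithin fun p hp => ?_
  obtain ⟨e, γ, K, r, he, hγ, hr, h⟩ := hΩ.exists_graph p hp
  refine ⟨Metric.ball p r ∩ frontier Ω,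
    Set.inter_comm _ _ ▸ inter_mem_nhdsWithin _ (Metric.ball_mem_nhds p hr), ?_⟩
  refine (measure_le_volume_preimage_graphMap he hγ fun x hx =>
    (mem_frontier_iff_of_graph hΩ.isOpen he hγ.continuous h hx.1).1 hx.2).trans_lt ?_
  refine ENNReal.mul_lt_top (by finiteness) ?_
  exact (measure_mono (Set.preimage_mono Set.inter_subset_left)).trans_lt
    (volume_preimage_graphMap_ball_lt_top e γ p r)

/-- Orthogonal projection does not increase Hausdorff measure, and it sends a patch of `Γ` onto a
set containing a nonempty open part of the hyperplane. -/
theorem surfaceMeasure_ne_zero (hΩ : IsBoundedLipschitzDomain Ω)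
    (hΓ : IsRelOpenBoundary Ω Γ) (hΓne : Γ.Nonempty) : surfaceMeasure Γ ≠ 0 := by
  intro h0
  have h1 : Measure.euclideanHausdorffMeasure (d - 1) Γ = 0 := by
    have := congrArg (fun μ : Measure (EuclideanSpace ℝ (Fin d)) => μ Set.univ) h0
    simpa [surfaceMeasure] using this
  obtain ⟨p, hp⟩ := hΓne
  obtain ⟨U, hU, rfl⟩ := hΓ
  obtain ⟨e, γ, K, r, he, hγ, hr, h⟩ := hΩ.exists_graph p hp.2
  obtain ⟨s, hs, hsU⟩ := Metric.isOpen_iff.1 hU p hp.1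
  have hgr := fun {x} (hx : x ∈ Metric.ball p r) =>
    mem_frontier_iff_of_graph hΩ.isOpen he hγ.continuous h hx
  have hπ : LipschitzWith 1 ((Submodule.span ℝ {e})ᗮ.orthogonalProjectionOnto) :=
    Submodule.lipschitzWith_orthogonalProjectionOnto _
  have h2 := hπ.euclideanHausdorffMeasure_image_le (d - 1) (U ∩ frontier Ω)
  rw [h1, mul_zero, nonpos_iff_eq_zero, euclideanHausdorffMeasure_hyperplane he] at h2
  have hopen : IsOpen (graphMap e γ ⁻¹' Metric.ball p (min r s)) :=
    Metric.isOpen_ball.preimage (lipschitzWith_graphMap he hγ).continuous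
  refine (hopen.measure_pos volume
    ⟨(Submodule.span ℝ {e})ᗮ.orthogonalProjectionOnto p, ?_⟩).ne' (measure_mono_null ?_ h2)
  · rw [Set.mem_preimage, graphMap_orthogonalProjectionOnto he
      ((hgr (Metric.mem_ball_self hr)).1 hp.2)]
    exact Metric.mem_ball_self (by positivity)
  · intro y hy
    have hyr : graphMap e γ y ∈ Metric.ball p r := Metric.ball_subset_ball (min_le_left _ _) hy
    have hys : graphMap e γ y ∈ Metric.ball p s := Metric.ball_subset_ball (min_le_right _ _) hy
    refine ⟨graphMap e γ y, ⟨hsU hys, (hgr hyr).2 ?_⟩, orthogonalProjectionOnto_graphMap e γ y⟩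
    rw [orthogonalProjectionOnto_graphMap, inner_graphMap he]

end Surface

/-! ### The trace inequality -/

section Trace

variable {d : ℕ} {Ω Γ : Set (EuclideanSpace ℝ (Fin d))}

/-- Tonelli for the orthogonal splitting of the space into the line of `e` and its complement. -/
theorem lintegral_hyperplane_line {e : EuclideanSpace ℝ (Fin d)} (he : ‖e‖ = 1)
    {F : EuclideanSpace ℝ (Fin d) → ℝ≥0∞} (hF : Measurable F) :
    ∫⁻ y : ↥(Submodule.span ℝ {e})ᗮ, ∫⁻ t : ℝ, F (y + t • e) = ∫⁻ x, F x := by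
  have h1 := (Submodule.span ℝ {e}).measurePreserving_measurableEquivProd
    (0 : EuclideanSpace ℝ (Fin d))
  rw [InnerProductSpace.euclideanHausdorffMeasure_eq_volume] at h1
  have h2 := h1.symm.lintegral_comp hF
  rw [← h2, Measure.volume_eq_prod, lintegral_prod_symm' _ (by fun_prop)]
  refine lintegral_congr fun y => ?_
  have h3 := (LinearIsometryEquiv.toSpanUnitSingleton (𝕜 := ℝ) e he).measurePreserving
  have h4 := h3.lintegral_comp (f := fun a => F (((Submodule.span ℝ {e}).measurableEquivProd
    (0 : EuclideanSpace ℝ (Fin d))).symm (a, y))) (by fun_prop)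
  rw [← h4]
  refine lintegral_congr fun t => ?_
  congr 1
  simp [add_comm]

/-- A one-dimensional trace inequality along a segment. -/
theorem ofReal_mul_enorm_sq_le_lintegral {φ : EuclideanSpace ℝ (Fin d) → ℂ} (hφ : ContDiff ℝ 1 φ)
    {e : EuclideanSpace ℝ (Fin d)} (he : ‖e‖ = 1) {δ : ℝ} (hδ : 0 < δ)
    (x : EuclideanSpace ℝ (Fin d)) :
    ENNReal.ofReal δ * ‖φ x‖ₑ ^ 2 ≤ ∫⁻ t in Set.Ioc 0 δ,
      ENNReal.ofReal (1 + δ) * (‖φ (x + t • e)‖ₑ ^ 2 + ‖fderiv ℝ φ (x + t • e)‖ₑ ^ 2) := by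
  set q : ℝ → ℂ := fun t => φ (x + t • e) with hq
  set q' : ℝ → ℂ := fun t => fderiv ℝ φ (x + t • e) e with hq'
  have hline : Continuous fun t : ℝ => x + t • e := by fun_prop
  have hqc : Continuous q := hφ.continuous.comp hline
  have hfc : Continuous fun t : ℝ => fderiv ℝ φ (x + t • e) :=
    (hφ.continuous_fderiv (by simp)).comp hline
  have hq'c : Continuous q' := hfc.clm_apply continuous_const
  have hqd : ∀ t, HasDerivAt q (q' t) t := by
    intro t
    have h1 : HasDerivAt (fun t : ℝ => x + t • e) e t := by
      simpa using ((hasDerivAt_id t).smul_const e).const_add x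
    exact ((hφ.differentiable (by simp)).differentiableAt.hasFDerivAt).comp_hasDerivAt t h1
  -- The weight `δ - t` vanishes at the far end, so the fundamental theorem of calculus leaves only
  -- `δ ‖φ x‖²`.
  have hd : ∀ t, HasDerivAt (fun t => (δ - t) * ‖q t‖ ^ 2)
      (-1 * ‖q t‖ ^ 2 + (δ - t) * (2 * inner ℝ (q t) (q' t))) t := by
    intro t
    exact ((hasDerivAt_id t).const_sub δ).mul (hqd t).norm_sq
  have hdc : Continuous fun t => -1 * ‖q t‖ ^ 2 + (δ - t) * (2 * inner ℝ (q t) (q' t)) := by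
    fun_prop
  have hftc := intervalIntegral.integral_eq_sub_of_hasDerivAt (a := 0) (b := δ)
    (fun t _ => hd t) (hdc.intervalIntegrable 0 δ)
  have hF : Continuous fun t => (1 + δ) * (‖q t‖ ^ 2 + ‖fderiv ℝ φ (x + t • e)‖ ^ 2) := by
    fun_prop
  have hle : δ * ‖φ x‖ ^ 2 ≤
      ∫ t in Set.Ioc 0 δ, (1 + δ) * (‖q t‖ ^ 2 + ‖fderiv ℝ φ (x + t • e)‖ ^ 2) := by
    rw [← intervalIntegral.integral_of_le hδ.le]
    have h0 : δ * ‖φ x‖ ^ 2 =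
        ∫ t in (0 : ℝ)..δ, -(-1 * ‖q t‖ ^ 2 + (δ - t) * (2 * inner ℝ (q t) (q' t))) := by
      rw [intervalIntegral.integral_neg, hftc]
      simp [hq]
    rw [h0]
    refine intervalIntegral.integral_mono_on hδ.le (hdc.neg.intervalIntegrable 0 δ)
      (hF.intervalIntegrable 0 δ) fun t ht => ?_
    have h1 : |inner ℝ (q t) (q' t)| ≤ ‖q t‖ * ‖q' t‖ := abs_real_inner_le_norm _ _
    have h2 : ‖q' t‖ ≤ ‖fderiv ℝ φ (x + t • e)‖ := by
      simpa [he] using (fderiv ℝ φ (x + t • e)).le_opNorm e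
    set D := ‖fderiv ℝ φ (x + t • e)‖
    have h3 : -(2 * inner ℝ (q t) (q' t)) ≤ ‖q t‖ ^ 2 + D ^ 2 := by
      have h4 := neg_abs_le (inner ℝ (q t) (q' t))
      have h5 : ‖q t‖ * ‖q' t‖ ≤ ‖q t‖ * D := mul_le_mul_of_nonneg_left h2 (norm_nonneg _)
      nlinarith [sq_nonneg (‖q t‖ - D)]
    have h6 : (δ - t) * -(2 * inner ℝ (q t) (q' t)) ≤ δ * (‖q t‖ ^ 2 + D ^ 2) := by
      refine (mul_le_mul_of_nonneg_left h3 (sub_nonneg.2 ht.2)).trans ?_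
      refine mul_le_mul_of_nonneg_right (by linarith [ht.1]) (by positivity)
    nlinarith [sq_nonneg D]
  have h := ENNReal.ofReal_le_ofReal hle
  rw [ofReal_integral_eq_lintegral_ofReal
    ((hF.integrableOn_Icc).mono_set Set.Ioc_subset_Icc_self)
    (Filter.Eventually.of_forall fun t => by positivity), ENNReal.ofReal_mul hδ.le,
    ENNReal.ofReal_pow (norm_nonneg _), ofReal_norm] at h
  refine h.trans (le_of_eq (lintegral_congr fun t => ?_))
  rw [ENNReal.ofReal_mul (by positivity),
    ENNReal.ofReal_add (p := ‖q t‖ ^ 2) (by positivity) (by positivity), ENNReal.ofReal_pow (norm_nonneg _), ENNReal.ofReal_pow (norm_nonneg _), ofReal_norm,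
    ofReal_norm]

/-- The energy density `|φ|^2 + |∇φ|^2`. -/
noncomputable def energyDensity (φ : EuclideanSpace ℝ (Fin d) → ℂ)
    (x : EuclideanSpace ℝ (Fin d)) : ℝ≥0∞ := ‖φ x‖ₑ ^ 2 + ‖fderiv ℝ φ x‖ₑ ^ 2

theorem measurable_energyDensity {φ : EuclideanSpace ℝ (Fin d) → ℂ} (hφ : ContDiff ℝ 1 φ) :
    Measurable (energyDensity φ) :=
  (hφ.continuous.measurable.enorm.pow_const 2).add
    ((hφ.continuous_fderiv (by simp)).measurable.enorm.pow_const 2)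

/-- Surface measure is dominated by Lebesgue measure on the base hyperplane. Over each base point
the one-dimensional inequality is applied on the vertical segment above the graph, and Tonelli
assembles these into an integral over `Ω`. -/
theorem exists_local_trace_inequality (hΩ : IsBoundedLipschitzDomain Ω)
    {p : EuclideanSpace ℝ (Fin d)} (hp : p ∈ frontier Ω) :
    ∃ s > 0, ∃ C : ℝ≥0, ∀ φ : EuclideanSpace ℝ (Fin d) → ℂ, ContDiff ℝ 1 φ →
      ∫⁻ x in Metric.ball p s ∩ frontier Ω, ‖φ x‖ₑ ^ 2 ∂(Measure.euclideanHausdorffMeasure (d - 1)) ≤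
        C * ∫⁻ x in Ω, energyDensity φ x := by
  obtain ⟨e, γ, K, r, he, hγ, hr, h⟩ := hΩ.exists_graph p hp
  -- Patch radius and segment length are both `δ`, so the segments stay in the chart of radius `r`.
  set δ := r / 2 with hδ
  have hδ0 : 0 < δ := by positivity
  set S := Metric.ball p δ ∩ frontier Ω with hS
  have hSm : MeasurableSet S := Metric.isOpen_ball.measurableSet.inter isClosed_frontier.measurableSet
  have hball : Metric.ball p δ ⊆ Metric.ball p r := Metric.ball_subset_ball (by linarith)
  have hSgraph : ∀ x ∈ S, γ ((Submodule.span ℝ {e})ᗮ.orthogonalProjectionOnto x) = inner ℝ e x :=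
    fun x hx => (mem_frontier_iff_of_graph hΩ.isOpen he hγ.continuous h (hball hx.1)).1 hx.2
  set G := graphMap e γ with hG
  have hGm : Measurable G := (lipschitzWith_graphMap he hγ).continuous.measurable
  set L : ℝ≥0∞ := ((1 + K : ℝ≥0) : ℝ≥0∞) ^ (d - 1) with hL
  have hmeas : (Measure.euclideanHausdorffMeasure (d - 1)).restrict S ≤
      L • (volume.restrict (G ⁻¹' S)).map G := by
    refine Measure.le_iff.2 fun A hA => ?_
    rw [Measure.restrict_apply hA, Measure.smul_apply, Measure.map_apply hGm hA,
      Measure.restrict_apply (hGm hA), smul_eq_mul]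
    exact measure_le_volume_preimage_graphMap he hγ fun x hx => hSgraph x hx.2
  set C : ℝ≥0∞ := L * ((ENNReal.ofReal δ)⁻¹ * ENNReal.ofReal (1 + δ)) with hC
  have hδe : ENNReal.ofReal δ ≠ 0 := by simpa using hδ0
  have hCt : C ≠ ⊤ := by
    rw [hC, hL]
    exact ENNReal.mul_ne_top (by finiteness)
      (ENNReal.mul_ne_top (ENNReal.inv_ne_top.2 hδe) ENNReal.ofReal_ne_top)
  refine ⟨δ, hδ0, C.toNNReal, fun φ hφ => ?_⟩
  rw [ENNReal.coe_toNNReal hCt]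
  have hEm := measurable_energyDensity hφ
  have hIm : Measurable (Ω.indicator (energyDensity φ)) := hEm.indicator hΩ.isOpen.measurableSet
  have hpoint : ∀ y ∈ G ⁻¹' S, ‖φ (G y)‖ₑ ^ 2 ≤ (ENNReal.ofReal δ)⁻¹ * ENNReal.ofReal (1 + δ) *
      ∫⁻ t : ℝ, Ω.indicator (energyDensity φ) (y + t • e) := by
    intro y hy
    have h1 := ofReal_mul_enorm_sq_le_lintegral hφ he hδ0 (G y)
    have h2 : ∫⁻ t in Set.Ioc 0 δ, ENNReal.ofReal (1 + δ) * (‖φ (G y + t • e)‖ₑ ^ 2 +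
        ‖fderiv ℝ φ (G y + t • e)‖ₑ ^ 2) ≤
        ENNReal.ofReal (1 + δ) * ∫⁻ t : ℝ, Ω.indicator (energyDensity φ) (y + t • e) := by
      rw [lintegral_const_mul' _ _ ENNReal.ofReal_ne_top]
      refine mul_le_mul_right ?_ _
      -- The shift by `γ y` makes the parameter start at the graph.
      rw [← lintegral_add_left_eq_self (fun t => Ω.indicator (energyDensity φ) (y + t • e)) (γ y)]
      refine le_trans (setLIntegral_mono' measurableSet_Ioc fun t ht => ?_)
        (setLIntegral_le_lintegral (Set.Ioc 0 δ) _)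
      have h3 : (y : EuclideanSpace ℝ (Fin d)) + (γ y + t) • e = G y + t • e := by
        rw [hG, graphMap, add_smul, add_assoc]
      have h4 : G y + t • e ∈ Ω := by
        refine (h _ ?_).2 ?_
        · have h5 : dist (G y + t • e) (G y) = t := by
            rw [dist_eq_norm, add_sub_cancel_left, norm_smul, he, mul_one,
              Real.norm_of_nonneg ht.1.le]
          have h6 := dist_triangle (G y + t • e) (G y) p
          have h7 := Metric.mem_ball.1 hy.1
          rw [Metric.mem_ball]
          linarith [ht.2]
        · rw [orthogonalProjectionOnto_add_smul_self, inner_add_smul_self he, hSgraph _ hy]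
          linarith [ht.1]
      rw [h3, Set.indicator_of_mem h4]
      rfl
    rw [mul_assoc, ← ENNReal.div_eq_inv_mul, ENNReal.le_div_iff_mul_le (Or.inl hδe)
      (Or.inl ENNReal.ofReal_ne_top), mul_comm]
    exact h1.trans h2
  calc ∫⁻ x in S, ‖φ x‖ₑ ^ 2 ∂(Measure.euclideanHausdorffMeasure (d - 1))
      ≤ ∫⁻ x, ‖φ x‖ₑ ^ 2 ∂(L • (volume.restrict (G ⁻¹' S)).map G) := lintegral_mono' hmeas le_rfl
    _ = L * ∫⁻ y in G ⁻¹' S, ‖φ (G y)‖ₑ ^ 2 := by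
        rw [lintegral_smul_measure, smul_eq_mul,
          lintegral_map (hφ.continuous.measurable.enorm.pow_const 2) hGm]
    _ ≤ L * ∫⁻ y in G ⁻¹' S, (ENNReal.ofReal δ)⁻¹ * ENNReal.ofReal (1 + δ) *
          ∫⁻ t : ℝ, Ω.indicator (energyDensity φ) (y + t • e) := by
        gcongr 1
        exact setLIntegral_mono' (hGm hSm) hpoint
    _ ≤ L * ∫⁻ y : ↥(Submodule.span ℝ {e})ᗮ, (ENNReal.ofReal δ)⁻¹ * ENNReal.ofReal (1 + δ) *
          ∫⁻ t : ℝ, Ω.indicator (energyDensity φ) (y + t • e) := by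
        gcongr 1
        exact setLIntegral_le_lintegral _ _
    _ = C * ∫⁻ x in Ω, energyDensity φ x := by
        rw [lintegral_const_mul' _ _ (ENNReal.mul_ne_top (ENNReal.inv_ne_top.2 hδe)
          ENNReal.ofReal_ne_top), lintegral_hyperplane_line he hIm,
          lintegral_indicator hΩ.isOpen.measurableSet, hC, mul_assoc, mul_assoc, mul_assoc]

/-- The trace inequality for smooth functions. -/
theorem exists_trace_inequality (hΩ : IsBoundedLipschitzDomain Ω) (hΓ : IsRelOpenBoundary Ω Γ) :
    ∃ C : ℝ≥0, ∀ φ : EuclideanSpace ℝ (Fin d) → ℂ, ContDiff ℝ 1 φ →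
      ∫⁻ x, ‖φ x‖ₑ ^ 2 ∂(surfaceMeasure Γ) ≤ C * ∫⁻ x in Ω, energyDensity φ x := by
  have key := hΩ.isCompact_frontier.induction_on
    (p := fun t => ∃ C : ℝ≥0, ∀ φ : EuclideanSpace ℝ (Fin d) → ℂ, ContDiff ℝ 1 φ →
      ∫⁻ x in t, ‖φ x‖ₑ ^ 2 ∂(Measure.euclideanHausdorffMeasure (d - 1)) ≤
        C * ∫⁻ x in Ω, energyDensity φ x) ⟨0, fun φ _ => by simp⟩ ?_ ?_ ?_
  · obtain ⟨C, hC⟩ := key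
    obtain ⟨U, -, rfl⟩ := hΓ
    exact ⟨C, fun φ hφ => (lintegral_mono_set Set.inter_subset_right).trans (hC φ hφ)⟩
  · rintro s t hst ⟨C, hC⟩
    exact ⟨C, fun φ hφ => (lintegral_mono_set hst).trans (hC φ hφ)⟩
  · rintro s t ⟨C, hC⟩ ⟨C', hC'⟩
    refine ⟨C + C', fun φ hφ => (lintegral_union_le _ s t).trans ?_⟩
    rw [ENNReal.coe_add, add_mul]
    exact add_le_add (hC φ hφ) (hC' φ hφ)
  · intro p hp
    obtain ⟨s, hs, hC⟩ := exists_local_trace_inequality hΩ hp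
    exact ⟨_, Set.inter_comm _ _ ▸ inter_mem_nhdsWithin _ (Metric.ball_mem_nhds p hs), hC⟩

end Trace

/-! ### The trace operator -/

section Trace

variable {d : ℕ} {Ω Γ : Set (EuclideanSpace ℝ (Fin d))}

/-- The weak gradient of a smooth function is its classical gradient. -/
theorem H1.grad_ae_eq_fderiv (hΩ : IsOpen Ω) (w : H1 Ω) {φ : EuclideanSpace ℝ (Fin d) → ℂ}
    (hφ : ContDiff ℝ ∞ φ) (hw : H1.toFun w =ᵐ[volume.restrict Ω] φ) (i : Fin d) :
    ∀ᵐ x ∂volume.restrict Ω, H1.grad w x i = fderiv ℝ φ x (EuclideanSpace.single i 1) := by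
  set e : EuclideanSpace ℝ (Fin d) := EuclideanSpace.single i 1 with he
  have hφd : Continuous fun x => fderiv ℝ φ x e :=
    (hφ.continuous_fderiv (by simp)).clm_apply continuous_const
  rw [ae_restrict_iff' hΩ.measurableSet]
  have key : ∀ᵐ x ∂(volume : Measure (EuclideanSpace ℝ (Fin d))),
      x ∈ Ω → H1.grad w x i - fderiv ℝ φ x e = 0 := by
    refine hΩ.ae_eq_zero_of_integral_contDiff_smul_eq_zero ?_ ?_
    · refine LocallyIntegrableOn.sub ?_ (hφd.locallyIntegrable.locallyIntegrableOn Ω)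
      exact locallyIntegrableOn_of_locallyIntegrable_restrict
        ((memLp_coord (H1.grad w) i).locallyIntegrable (by norm_num))
    · intro g hg hc hs
      have hgd : Continuous fun x => fderiv ℝ g x e :=
        (hg.continuous_fderiv (by simp)).clm_apply continuous_const
      have hgdc : HasCompactSupport fun x => fderiv ℝ g x e := hc.fderiv_apply (𝕜 := ℝ) _
      have hg0 : ∀ x, x ∉ Ω → g x = 0 := fun x hx =>
        image_eq_zero_of_notMem_tsupport fun h => hx (hs h)
      have hi1 : Integrable (fun x => g x • fderiv ℝ φ x e) :=
        (hg.continuous.smul hφd).integrable_of_hasCompactSupport hc.smul_right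
      have h1 := integral_smul_fderiv_eq_neg_fderiv_smul_of_integrable (μ := volume) (f := g)
        (g := φ) (v := e)
        ((hgd.smul hφ.continuous).integrable_of_hasCompactSupport hgdc.smul_right) hi1
        ((hg.continuous.smul hφ.continuous).integrable_of_hasCompactSupport hc.smul_right)
        (fun x _ => (hg.differentiable (by simp)).differentiableAt)
        (fun x _ => (hφ.differentiable (by simp)).differentiableAt)
      have h2 : ∫ x, fderiv ℝ g x e • φ x = - ∫ x in Ω, g x • H1.grad w x i := by
        have hwg : ∫ x in Ω, fderiv ℝ g x e • H1.toFun w x = - ∫ x in Ω, g x • H1.grad w x i :=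
          w.2 g hg hc hs i
        rw [← hwg, ← setIntegral_eq_integral_of_forall_compl_eq_zero (s := Ω)]
        · refine integral_congr_ae ?_
          filter_upwards [hw] with x hx
          exact congrArg (fderiv ℝ g x e • ·) hx.symm
        · intro x hx
          rw [fderiv_of_notMem_tsupport ℝ (fun h => hx (hs h)), zero_apply, zero_smul]
      rw [h2, neg_neg, ← setIntegral_eq_integral_of_forall_compl_eq_zero (s := Ω)
        fun x hx => by rw [hg0 x hx, zero_smul]] at h1
      rw [← setIntegral_eq_integral_of_forall_compl_eq_zero (s := Ω)
        fun x hx => by rw [hg0 x hx, zero_smul]]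
      simp only [smul_sub]
      rw [integral_sub (integrable_smul_L2Dom hg.continuous hc (memLp_coord _ i)) hi1.restrict,
        h1, sub_self]
  filter_upwards [key] with x hx hxΩ
  exact sub_eq_zero.1 (hx hxΩ)

theorem H1.norm_fderiv_le_ae (hΩ : IsOpen Ω) (w : H1 Ω) {φ : EuclideanSpace ℝ (Fin d) → ℂ}
    (hφ : ContDiff ℝ ∞ φ) (hw : H1.toFun w =ᵐ[volume.restrict Ω] φ) :
    ∀ᵐ x ∂volume.restrict Ω, ‖fderiv ℝ φ x‖ ≤ ‖H1.grad w x‖ := by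
  filter_upwards [ae_all_iff.2 (H1.grad_ae_eq_fderiv hΩ w hφ hw)] with x hx
  refine ContinuousLinearMap.opNorm_le_bound _ (norm_nonneg _) fun v => ?_
  have hv : v = ∑ i, v i • EuclideanSpace.single i (1 : ℝ) := by
    conv_lhs => rw [← (EuclideanSpace.basisFun (Fin d) ℝ).sum_repr v]
    simp
  have h1 : fderiv ℝ φ x v = dirDeriv v (H1.grad w) x := by
    conv_lhs => rw [hv]
    rw [map_sum, dirDeriv]
    exact Finset.sum_congr rfl fun i _ => by rw [map_smul, hx i]
  rw [h1, mul_comm]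
  exact norm_dirDeriv_le v _ x

theorem H1.lintegral_energyDensity_le (hΩ : IsOpen Ω) (w : H1 Ω)
    {φ : EuclideanSpace ℝ (Fin d) → ℂ}
    (hφ : ContDiff ℝ ∞ φ) (hw : H1.toFun w =ᵐ[volume.restrict Ω] φ) :
    ∫⁻ x in Ω, energyDensity φ x ≤ ‖w‖ₑ ^ 2 := by
  have h1 : ∫⁻ x in Ω, energyDensity φ x ≤
      ∫⁻ x in Ω, (‖H1.toFun w x‖ₑ ^ 2 + ‖H1.grad w x‖ₑ ^ 2) := by
    refine lintegral_mono_ae ?_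
    filter_upwards [hw, H1.norm_fderiv_le_ae hΩ w hφ hw] with x hx hx'
    rw [energyDensity, hx]
    gcongr
    exact enorm_le_iff_norm_le.2 hx'
  refine h1.trans (le_of_eq ?_)
  rw [lintegral_add_left' ((Lp.aestronglyMeasurable _).enorm.pow_const 2), ← eLpNorm_two_sq,
    ← eLpNorm_two_sq, ← Lp.enorm_def, ← Lp.enorm_def]
  simp only [← ofReal_norm]
  rw [← ENNReal.ofReal_pow (norm_nonneg _), ← ENNReal.ofReal_pow (norm_nonneg _),
    ← ENNReal.ofReal_pow (norm_nonneg _), ← ENNReal.ofReal_add (by positivity) (by positivity),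
    H1.norm_sq_eq]

theorem exists_eLpNorm_boundary_le (hΩ : IsBoundedLipschitzDomain Ω) (hΓ : IsRelOpenBoundary Ω Γ) :
    ∃ C : ℝ≥0, ∀ (w : H1 Ω) (φ : EuclideanSpace ℝ (Fin d) → ℂ), ContDiff ℝ ∞ φ →
      H1.toFun w =ᵐ[volume.restrict Ω] φ → eLpNorm φ 2 (surfaceMeasure Γ) ≤ C * ‖w‖ₑ := by
  obtain ⟨C, hC⟩ := exists_trace_inequality hΩ hΓ
  -- The trace inequality bounds squares, and `C ≤ (C + 1)²` avoids a square root.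
  refine ⟨C + 1, fun w φ hφ hw => ?_⟩
  rw [← ENNReal.pow_le_pow_left_iff two_ne_zero, eLpNorm_two_sq, mul_pow]
  refine (hC φ (hφ.of_le (by simp))).trans (mul_le_mul' ?_
    (H1.lintegral_energyDensity_le hΩ.isOpen w hφ hw))
  norm_cast
  nlinarith [C.2]

/-- The pairs of an element of `H^1(Ω)` and a smooth representative of it. -/
def smoothPairs (Ω : Set (EuclideanSpace ℝ (Fin d))) :
    Submodule ℂ (H1 Ω × (EuclideanSpace ℝ (Fin d) → ℂ)) where
  carrier := {p | ContDiff ℝ ∞ p.2 ∧ H1.toFun p.1 =ᵐ[volume.restrict Ω] p.2}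
  zero_mem' := ⟨contDiff_const, Lp.coeFn_zero ℂ 2 _⟩
  add_mem' := fun hp hq =>
    ⟨hp.1.add hq.1, (Lp.coeFn_add _ _).trans (hp.2.add hq.2)⟩
  smul_mem' := fun c _ hp =>
    ⟨hp.1.const_smul c, (Lp.coeFn_smul c _).trans (hp.2.const_smul c)⟩

/-- Restriction to `Γ` extends by continuity to the closure of the functions with a smooth
representative, and by zero on the orthogonal complement. Density of these functions in `H¹(Ω)` is
therefore not needed. -/
theorem exists_isTraceOp (hΩ : IsBoundedLipschitzDomain Ω) (hΓ : IsRelOpenBoundary Ω Γ) :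
    ∃ T, IsTraceOp Ω Γ T := by
  obtain ⟨C, hC⟩ := exists_eLpNorm_boundary_le hΩ hΓ
  have hmem : ∀ p : smoothPairs Ω, MemLp p.1.2 2 (surfaceMeasure Γ) := fun p =>
    ⟨p.2.1.continuous.aestronglyMeasurable,
      (hC _ _ p.2.1 p.2.2).trans_lt (ENNReal.mul_lt_top ENNReal.coe_lt_top enorm_lt_top)⟩
  -- The map is defined on pairs, so no representative has to be chosen; the norm bound below makes
  -- its value depend only on the element of `H1 Ω`.
  let f : smoothPairs Ω →ₗ[ℂ] L2Bd Γ :=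
    { toFun := fun p => (hmem p).toLp p.1.2
      map_add' := fun p q => MemLp.toLp_add (hmem p) (hmem q)
      map_smul' := fun c p => MemLp.toLp_const_smul c (hmem p) }
  let e₀ : smoothPairs Ω →ₗ[ℂ] H1 Ω := LinearMap.fst ℂ _ _ ∘ₗ (smoothPairs Ω).subtype
  let K : Submodule ℂ (H1 Ω) := (LinearMap.range e₀).topologicalClosure
  have hK : ∀ p, e₀ p ∈ K := fun p =>
    (LinearMap.range e₀).le_topologicalClosure (LinearMap.mem_range_self e₀ p)
  let e : smoothPairs Ω →ₗ[ℂ] K := e₀.codRestrict K hK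
  have : CompleteSpace K := (LinearMap.range e₀).isClosed_topologicalClosure.completeSpace_coe
  have hdense : DenseRange e := by
    intro x
    rw [closure_subtype, ← Set.range_comp]
    exact x.2
  have hnorm : ∃ C : ℝ, ∀ p, ‖f p‖ ≤ C * ‖e p‖ := by
    refine ⟨C, fun p => ?_⟩
    change ‖(hmem p).toLp p.1.2‖ ≤ C * ‖p.1.1‖
    rw [Lp.norm_toLp]
    refine ENNReal.toReal_le_of_le_ofReal (by positivity) ((hC _ _ p.2.1 p.2.2).trans_eq ?_)
    rw [ENNReal.ofReal_mul C.coe_nonneg, ofReal_norm, ENNReal.ofReal_coe_nnreal]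
  refine ⟨(f.extendOfNorm e).comp K.orthogonalProjectionOnto, fun w φ hφ hw => ?_⟩
  let p : smoothPairs Ω := ⟨(w, φ), hφ, hw⟩
  have h1 : K.orthogonalProjectionOnto w = e p :=
    Submodule.orthogonalProjectionOnto_mem_subspace_eq_self (e p)
  have h2 : ((f.extendOfNorm e).comp K.orthogonalProjectionOnto) w = f p := by
    rw [ContinuousLinearMap.comp_apply, h1]
    exact LinearMap.extendOfNorm_eq hdense hnorm p
  rw [h2]
  exact (hmem p).coeFn_toLp

theorem isTraceOp_traceOp (hΩ : IsBoundedLipschitzDomain Ω) (hΓ : IsRelOpenBoundary Ω Γ) :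
    IsTraceOp Ω Γ (traceOp Ω Γ) :=
  Classical.epsilon_spec (exists_isTraceOp hΩ hΓ)

end Trace

/-! ### The main theorem -/

theorem mainTheorem1 {d : ℕ} (hd : 2 ≤ d) (Ω Γ : Set (EuclideanSpace ℝ (Fin d)))
    (hΩ : IsBoundedLipschitzDomain Ω) (hΓ : IsRelOpenBoundary Ω Γ) (hΓne : Γ.Nonempty) :
    -- the objects are well defined
    IsTraceOp Ω Γ (traceOp Ω Γ) ∧
    (∃ C : ℝ, ∀ w : H1Mean Ω Γ, ‖w‖ ^ 2 ≤ C * ‖H1.grad (w : H1 Ω)‖ ^ 2) ∧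
    (∀ A ∈ ellipticCoeff Ω,
      (∀ (f : L2Mean Γ) (u : H1Mean Ω Γ), IsWeakSolution A f u ↔ u = solOp Ω Γ A f) ∧
      (∀ (B : Coeff Ω) (y z : H1Mean Ω Γ),
        IsPerturbSolution A B y z ↔ z = perturbOp Ω Γ A B y)) ∧
    -- smoothness and analyticity on the open set of elliptic coefficients
    IsOpen (ellipticCoeff Ω) ∧
    ContDiffOn ℂ ∞ (solOp Ω Γ) (ellipticCoeff Ω) ∧
    ContDiffOn ℂ ∞ (ndMap Ω Γ) (ellipticCoeff Ω) ∧
    AnalyticOnNhd ℂ (solOp Ω Γ) (ellipticCoeff Ω) ∧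
    AnalyticOnNhd ℂ (ndMap Ω Γ) (ellipticCoeff Ω) ∧
    -- the derivatives
    (∀ A ∈ ellipticCoeff Ω, ∀ (k : ℕ) (B : Fin k → Coeff Ω),
      iteratedFDeriv ℂ k (solOp Ω Γ) A B =
        (∑ α : Equiv.Perm (Fin k),
          (List.ofFn fun i : Fin k => perturbOp Ω Γ A (B (α i))).prod) ∘L solOp Ω Γ A ∧
      iteratedFDeriv ℂ k (ndMap Ω Γ) A B =
        traceMean Ω Γ ∘L iteratedFDeriv ℂ k (solOp Ω Γ) A B) ∧
    -- the Taylor series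
    (∀ A ∈ ellipticCoeff Ω, ∀ c : ℝ, 0 < c → IsEllipticityConst A c →
      ∀ B : Coeff Ω, ‖B‖ < c →
        A + B ∈ ellipticCoeff Ω ∧
        HasSum (fun k : ℕ =>
          ((k.factorial : ℂ)⁻¹) • iteratedFDeriv ℂ k (solOp Ω Γ) A (fun _ => B))
          (solOp Ω Γ (A + B)) ∧
        HasSum (fun k : ℕ => (perturbOp Ω Γ A B ^ k) ∘L solOp Ω Γ A) (solOp Ω Γ (A + B)) ∧
        HasSum (fun k : ℕ =>
          ((k.factorial : ℂ)⁻¹) • iteratedFDeriv ℂ k (ndMap Ω Γ) A (fun _ => B))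
          (ndMap Ω Γ (A + B)) ∧
        ndMap Ω Γ (A + B) =
          traceMean Ω Γ ∘L (∑' k : ℕ, (perturbOp Ω Γ A B ^ k) ∘L solOp Ω Γ A)) := by
  have hfin := isFiniteMeasure_surfaceMeasure hΩ hΓ
  have hpos := surfaceMeasure_ne_zero hΩ hΓ hΓne
  have hT := isTraceOp_traceOp hΩ hΓ
  have hvol := hΩ.volume_ne_top
  obtain ⟨C, hC⟩ := exists_poincare_H1Mean hΩ hpos hT
  have han := analyticOnNhd_solOp hpos hT hvol hC
  have hanΛ := analyticOnNhd_ndMap hpos hT hvol hC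
  have hopen : IsOpen (ellipticCoeff Ω) := isOpen_ellipticCoeff
  refine ⟨hT, ⟨C, hC⟩, fun A hA => ⟨fun f u => isWeakSolution_iff_eq_solOp hpos hT hvol hC hA f u,
    fun B y z => isPerturbSolution_iff_eq_perturbOp hpos hT hvol hC hA B y z⟩, hopen,
    han.contDiffOn hopen.uniqueDiffOn, hanΛ.contDiffOn hopen.uniqueDiffOn, han, hanΛ,
    fun A hA k B => ⟨iteratedFDeriv_eq_sum_perm _ _ (eventually_solOp_eq hpos hT hvol hC hA) k B,
      iteratedFDeriv_ndMap hpos hT hvol hC hA k B⟩, fun A hA c hc hAc B hB => ?_⟩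
  have hsum := hasSum_perturbOp_pow hpos hT hvol hC hc hAc hB
  have hterm := inv_factorial_smul_iteratedFDeriv_solOp hpos hT hvol hC hA B
  refine ⟨⟨_, sub_pos.2 hB, hAc.add⟩, ?_, hsum, ?_, ?_⟩
  · exact (funext hterm).symm ▸ hsum
  · have h := hsum.clm_comp_left (traceMean Ω Γ)
    have hterm' : ∀ k : ℕ,
        ((k.factorial : ℂ)⁻¹) • iteratedFDeriv ℂ k (ndMap Ω Γ) A (fun _ => B) =
          traceMean Ω Γ ∘L (perturbOp Ω Γ A B ^ k) ∘L solOp Ω Γ A := fun k => by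
      rw [iteratedFDeriv_ndMap hpos hT hvol hC hA, ← hterm k]
      exact (ContinuousLinearMap.comp_smul _ _ _).symm
    exact (funext hterm').symm ▸ h
  · exact congrArg (traceMean Ω Γ ∘L ·) hsum.tsum_eq.symm
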